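/- **Setting.** There are $n\ge 1$ agents and a set $M$ of $m\ge 0$ indivisible items. Agent $i$ has a valuation $v_i\colon 2^M\to\mathbb R$ with $|v_i(X\cup\{e\})-v_i(X)|\le 1$ for all $e\in M$ and $X\subseteq M\setminus\{e\}$. An item $e$ is a good for agent $i$ if $v_i(X\cup\{e\})\ge v_i(X)$ for all $X\subseteq M\setminus\{e\}$, and a chore for $i$ if $v_i(X\cup\{e\})\le v_i(X)$ for all $X\subseteq M\setminus\{e\}$ with at least one strict inequality. The valuations are doubly monotone if for every agent each item is a good or a chore. An allocation is an ordered partition $A=(A_1,\dots,A_n)$ of $M$ into possibly empty bundles; it is EF$k$ if for all $i,j$ there is $X\subseteq A_i\cup A_j$ with $|X|\le k$ and $v_i(A_i\setminus X)\ge v_i(A_j\setminus X)$. An envy-free allocation with a subsidy is a pair $(A,p)$ of an allocation $A$ and a vector $p\in\mathbb R_{\ge 0}^n$ with $v_i(A_i)+p_i\ge v_i(A_j)+p_j$ for all $i,j$. "In polynomial time" means: by a single algorithm whose number of steps is bounded by a polynomial in $n+m$, on a random access machine whose elementary operations are additions, subtractions and comparisons of natural and of real numbers and memory accesses, and which accesses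 the valuations only through value queries (given $i$ and $X$, obtain $v_i(X)$). **Theorem 1.** (a) If the valuations are doubly monotone, or if $n=2$, then there is an envy-free allocation with a subsidy $(A,p)$ such that $p_i\le n-1$ for every agent $i$ and $\sum_{i=1}^n p_i\le n(n-1)/2$. Moreover, such a pair $(A,p)$ can be computed in polynomial time. (b) For arbitrary valuations as above, every $k\ge 0$ and every EF$k$ allocation $A$, there are a permutation $\sigma$ of the agents and a vector $p$ such that $(A_{\sigma(1)},\dots,A_{\sigma(n)})$ with $p$ is an envy-free allocation with a subsidy, $p_i\le k(n-1)$ for every agent $i$, and $\sum_{i=1}^n p_i\le k\cdot n(n-1)/2$. Moreover, given $A$, such an allocation and subsidy can be computed in polynomial time. -/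

import Mathlib

namespace FairDivision

/-! ## The fair division model

The agents are the elements of `Fin n`, the items the elements of `Fin m`. -/

/-- `v i X` is the value that agent `i` assigns to the set `X` of items. -/
abbrev Valuations (n m : ℕ) := Fin n → Finset (Fin m) → ℝ

/-- Every marginal contribution of an item has absolute value at most one. -/
def UnitMarginals {n m : ℕ} (v : Valuations n m) : Prop :=
  ∀ (i : Fin n) (e : Fin m) (X : Finset (Fin m)), e ∉ X → |v i (insert e X) - v i X| ≤ 1

def IsGood {n m : ℕ} (v : Valuations n m) (i : Fin n) (e : Fin m) : Prop :=
  ∀ X : Finset (Fin m), e ∉ X → v i X ≤ v i (insert e X)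

def IsChore {n m : ℕ} (v : Valuations n m) (i : Fin n) (e : Fin m) : Prop :=
  (∀ X : Finset (Fin m), e ∉ X → v i (insert e X) ≤ v i X) ∧
    ∃ X : Finset (Fin m), e ∉ X ∧ v i (insert e X) < v i X

def DoublyMonotone {n m : ℕ} (v : Valuations n m) : Prop :=
  ∀ (i : Fin n) (e : Fin m), IsGood v i e ∨ IsChore v i e

/-- An ordered partition of the items into (possibly empty) bundles, one for each agent. -/
def IsAllocation {n m : ℕ} (A : Fin n → Finset (Fin m)) : Prop :=
  (∀ i j : Fin n, i ≠ j → Disjoint (A i) (A j)) ∧ ∀ e : Fin m, ∃ i : Fin n, e ∈ A i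

/-- Envy-freeness up to `k` items. -/
def IsEFUpTo {n m : ℕ} (v : Valuations n m) (k : ℕ) (A : Fin n → Finset (Fin m)) : Prop :=
  ∀ i j : Fin n, ∃ X : Finset (Fin m),
    X ⊆ A i ∪ A j ∧ X.card ≤ k ∧ v i (A j \ X) ≤ v i (A i \ X)

/-- `(A, p)` is an envy-free allocation with a subsidy. -/
def IsEnvyFreeWithSubsidy {n m : ℕ} (v : Valuations n m)
    (A : Fin n → Finset (Fin m)) (p : Fin n → ℝ) : Prop :=
  IsAllocation A ∧ (∀ i : Fin n, 0 ≤ p i) ∧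
    ∀ i j : Fin n, v i (A j) + p j ≤ v i (A i) + p i

/-! ## Programs with value oracles

A structured random access machine with natural number variables, two-dimensional arrays of
natural numbers and two-dimensional arrays of real numbers. Natural and real numbers can only be
added, subtracted and compared (there is no multiplication, division or rounding, so that numbers
grow by at most one bit per operation); every elementary operation takes one step. The
valuations can only be accessed by value queries. A program is a finite piece of text that is
independent of the numbers of agents and items. -/

structure Store where
  /-- the natural number variables -/
  var : ℕ → ℕ
  /-- `arr a i j` is the entry in row `i` and column `j` of the array `a` of natural numbers -/
  arr : ℕ → ℕ → ℕ → ℕ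
  /-- `real a i j` is the entry in row `i` and column `j` of the array `a` of real numbers -/
  real : ℕ → ℕ → ℕ → ℝ

def Store.setVar (s : Store) (x k : ℕ) : Store :=
  { s with var := fun y => if y = x then k else s.var y }

def Store.setArr (s : Store) (a i j k : ℕ) : Store :=
  { s with arr := fun a' i' j' => if a' = a ∧ i' = i ∧ j' = j then k else s.arr a' i' j' }

noncomputable def Store.setReal (s : Store) (a i j : ℕ) (r : ℝ) : Store :=
  { s with real := fun a' i' j' => if a' = a ∧ i' = i ∧ j' = j then r else s.real a' i' j' }

/-- The set of items whose characteristic vector is stored in row `i` of the array `a`. -/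
def Store.itemSet (s : Store) (m a i : ℕ) : Finset (Fin m) :=
  Finset.univ.filter fun e => s.arr a i e ≠ 0

/-- Expressions for natural numbers. The subtraction is truncated. -/
inductive NatExpr where
  | const (k : ℕ)
  | var (x : ℕ)
  | arr (a : ℕ) (i j : NatExpr)
  | add (e f : NatExpr)
  | sub (e f : NatExpr)

def NatExpr.eval (s : Store) : NatExpr → ℕ
  | const k => k
  | var x => s.var x
  | arr a i j => s.arr a (i.eval s) (j.eval s)
  | add e f => e.eval s + f.eval s
  | sub e f => e.eval s - f.eval s

/-- The number of steps that it takes to evaluate an expression. -/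
def NatExpr.cost : NatExpr → ℕ
  | const _ => 1
  | var _ => 1
  | arr _ i j => i.cost + j.cost + 1
  | add e f => e.cost + f.cost + 1
  | sub e f => e.cost + f.cost + 1

/-- Expressions for real numbers. -/
inductive RealExpr where
  | zero
  | one
  | arr (a : ℕ) (i j : NatExpr)
  | add (e f : RealExpr)
  | sub (e f : RealExpr)

noncomputable def RealExpr.eval (s : Store) : RealExpr → ℝ
  | zero => 0
  | one => 1
  | arr a i j => s.real a (i.eval s) (j.eval s)
  | add e f => e.eval s + f.eval s
  | sub e f => e.eval s - f.eval s

def RealExpr.cost : RealExpr → ℕ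
  | zero => 1
  | one => 1
  | arr _ i j => i.cost + j.cost + 1
  | add e f => e.cost + f.cost + 1
  | sub e f => e.cost + f.cost + 1

/-- Tests. -/
inductive Cond where
  | natEq (e f : NatExpr)
  | natLe (e f : NatExpr)
  | realLe (e f : RealExpr)
  | not (b : Cond)
  | and (b c : Cond)

def Cond.Holds (s : Store) : Cond → Prop
  | natEq e f => e.eval s = f.eval s
  | natLe e f => e.eval s ≤ f.eval s
  | realLe e f => e.eval s ≤ f.eval s
  | not b => ¬ b.Holds s
  | and b c => b.Holds s ∧ c.Holds s

def Cond.cost : Cond → ℕ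
  | natEq e f => e.cost + f.cost + 1
  | natLe e f => e.cost + f.cost + 1
  | realLe e f => e.cost + f.cost + 1
  | not b => b.cost + 1
  | and b c => b.cost + c.cost + 1

inductive Program where
  | skip
  /-- `x := e` -/
  | setVar (x : ℕ) (e : NatExpr)
  /-- `arr a i j := e` -/
  | setArr (a : ℕ) (i j e : NatExpr)
  /-- `real a i j := e` -/
  | setReal (a : ℕ) (i j : NatExpr) (e : RealExpr)
  /-- `real a i j :=` the value, for the agent `g`, of the set of items that is stored in row `r`
  of the array `b` -/
  | query (a : ℕ) (i j g : NatExpr) (b : ℕ) (r : NatExpr)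
  | seq (c d : Program)
  | ite (b : Cond) (c d : Program)
  | while (b : Cond) (c : Program)

/-- `Exec v c s t s'`: with value oracles for the valuations `v`, the program `c`, started in the
store `s`, halts after exactly `t` steps in the store `s'`. A value query takes `m + 1` steps in
addition to the evaluation of its arguments, and is possible for the agents `0, …, n - 1` only. -/
inductive Exec {n m : ℕ} (v : Valuations n m) : Program → Store → ℕ → Store → Prop
  | skip (s : Store) : Exec v .skip s 1 s
  | setVar (s : Store) (x : ℕ) (e : NatExpr) :
      Exec v (.setVar x e) s (e.cost + 1) (s.setVar x (e.eval s))
  | setArr (s : Store) (a : ℕ) (i j e : NatExpr) :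
      Exec v (.setArr a i j e) s (i.cost + j.cost + e.cost + 1)
        (s.setArr a (i.eval s) (j.eval s) (e.eval s))
  | setReal (s : Store) (a : ℕ) (i j : NatExpr) (e : RealExpr) :
      Exec v (.setReal a i j e) s (i.cost + j.cost + e.cost + 1)
        (s.setReal a (i.eval s) (j.eval s) (e.eval s))
  | query (s : Store) (a : ℕ) (i j g : NatExpr) (b : ℕ) (r : NatExpr) (hg : g.eval s < n) :
      Exec v (.query a i j g b r) s (i.cost + j.cost + g.cost + r.cost + m + 1)
        (s.setReal a (i.eval s) (j.eval s) (v ⟨g.eval s, hg⟩ (s.itemSet m b (r.eval s))))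
  | seq {s₀ s₁ s₂ : Store} {c d : Program} {t₁ t₂ : ℕ} :
      Exec v c s₀ t₁ s₁ → Exec v d s₁ t₂ s₂ → Exec v (.seq c d) s₀ (t₁ + t₂) s₂
  | iteTrue {s s' : Store} {b : Cond} {c d : Program} {t : ℕ} :
      b.Holds s → Exec v c s t s' → Exec v (.ite b c d) s (b.cost + 1 + t) s'
  | iteFalse {s s' : Store} {b : Cond} {c d : Program} {t : ℕ} :
      ¬ b.Holds s → Exec v d s t s' → Exec v (.ite b c d) s (b.cost + 1 + t) s'
  | whileTrue {s₀ s₁ s₂ : Store} {b : Cond} {c : Program} {t₁ t₂ : ℕ} :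
      b.Holds s₀ → Exec v c s₀ t₁ s₁ → Exec v (.while b c) s₁ t₂ s₂ →
        Exec v (.while b c) s₀ (b.cost + 1 + t₁ + t₂) s₂
  | whileFalse {s : Store} {b : Cond} {c : Program} :
      ¬ b.Holds s → Exec v (.while b c) s (b.cost + 1) s

/-- The initial store: the variables `0` and `1` hold the numbers of agents and of items,
everything else is zero. -/
def Store.input (n m : ℕ) : Store where
  var x := if x = 0 then n else if x = 1 then m else 0
  arr _ _ _ := 0
  real _ _ _ := 0

/-- The initial store of a program that is given an allocation: as before, but row `i` of the
array `0` holds the characteristic vector of the bundle of agent `i`. -/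
def Store.inputAllocation {n m : ℕ} (A : Fin n → Finset (Fin m)) : Store :=
  { Store.input n m with
    arr := fun a i e =>
      if ∃ (hi : i < n) (he : e < m), a = 0 ∧ (⟨e, he⟩ : Fin m) ∈ A ⟨i, hi⟩ then 1 else 0 }

/-- The allocation in the final store: row `i` of the array `0` of natural numbers holds the
characteristic vector of the bundle of agent `i`. -/
def Store.outputAllocation (s : Store) (n m : ℕ) : Fin n → Finset (Fin m) :=
  fun i => s.itemSet m 0 i

/-- The subsidy in the final store: row `0` of the array `0` of real numbers. -/
def Store.outputSubsidy (s : Store) (n : ℕ) : Fin n → ℝ :=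
  fun i => s.real 0 0 i

end FairDivision

namespace FairDivision

/-! ## Time-bounded execution of programs -/

/-! The proof separates bundling the items from assigning and subsidizing the bundles.

Suppose given bundles can be assigned so that no agent envies another by more than `k`. Match agents
and bundles with maximum total value, take supporting prices, and make these minimal: from every
bundle with positive price, a chain of indifferences then leads down to price zero. In increasing
order, consecutive prices differ by at most `k`. Indeed, across a larger gap the reference
assignment would have to map the agents with high prices onto the bundles with high prices, and an
indifference crossing the gap would then reveal envy above `k` in it. So the prices are at most `0,
k, 2k, …`, which gives both bounds (`bounds_of_gap_le`, `price_bounds`).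

For part (b) the given bundles qualify, since removing `k` items in all changes a comparison of two
bundles by at most `k` (`IsEFUpTo.envy_le`). For part (a), bundles with `k = 1` are needed. With two
agents, cut and choose works (`exists_balanced`). For doubly monotone valuations the items are added
one by one. Rematching with truncated weights first ensures that agents envy only bundles of
strictly lower price (`exists_improved_matching`). Then a good goes to the highest priced agent
among those for whom it is a good, and an item that is a chore for all goes to the lowest priced
agent (`AlmostEnvyFree.exists_insert`).

All matchings and prices come from one Hungarian method, built on growing a tree of indifferences
and using only additions, subtractions and comparisons (`runs_growTree`, `runs_matchColumns`). Its
correctness proof also supplies the existence of supporting prices. -/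

open Polynomial in
/-- A bound on the number of steps of a program all of whose loops have at most `n + m + 1`
iterations, as a polynomial in `n + m`. -/
noncomputable def Program.timeBound : Program → Polynomial ℕ
  | skip => 1
  | setVar _ e => C (e.cost + 1)
  | setArr _ i j e => C (i.cost + j.cost + e.cost + 1)
  | setReal _ i j e => C (i.cost + j.cost + e.cost + 1)
  | query _ i j g _ r => C (i.cost + j.cost + g.cost + r.cost + 1) + X
  | seq c d => c.timeBound + d.timeBound
  | ite b c d => C (b.cost + 1) + (c.timeBound + d.timeBound)
  | .while b c => (X + 2) * (C (b.cost + 1) + c.timeBound)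

/-- The variables that a program may change. -/
def Program.vars : Program → List ℕ
  | setVar x _ => [x]
  | seq c d => c.vars ++ d.vars
  | ite _ c d => c.vars ++ d.vars
  | .while _ c => c.vars
  | _ => []

/-- The arrays of natural numbers that a program may change. -/
def Program.arrs : Program → List ℕ
  | setArr a _ _ _ => [a]
  | seq c d => c.arrs ++ d.arrs
  | ite _ c d => c.arrs ++ d.arrs
  | .while _ c => c.arrs
  | _ => []

/-- The arrays of real numbers that a program may change. -/
def Program.reals : Program → List ℕ
  | setReal a _ _ _ => [a]
  | query a _ _ _ _ _ => [a]
  | seq c d => c.reals ++ d.reals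
  | ite _ c d => c.reals ++ d.reals
  | .while _ c => c.reals
  | _ => []

/-- The stores `s` and `s'` agree on everything that the program `c` cannot change. -/
structure Frame (c : Program) (s s' : Store) : Prop where
  var : ∀ y, y ∉ c.vars → s'.var y = s.var y
  arr : ∀ a, a ∉ c.arrs → s'.arr a = s.arr a
  real : ∀ a, a ∉ c.reals → s'.real a = s.real a

theorem Frame.refl (c : Program) (s : Store) : Frame c s s :=
  ⟨fun _ _ => rfl, fun _ _ => rfl, fun _ _ => rfl⟩

theorem Frame.trans {c : Program} {s₀ s₁ s₂ : Store} (h : Frame c s₀ s₁) (h' : Frame c s₁ s₂) :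
    Frame c s₀ s₂ :=
  ⟨fun y hy => (h'.var y hy).trans (h.var y hy), fun y hy => (h'.arr y hy).trans (h.arr y hy),
    fun y hy => (h'.real y hy).trans (h.real y hy)⟩

theorem Frame.mono {c d : Program} {s s' : Store} (h : Frame c s s')
    (h₁ : c.vars ⊆ d.vars) (h₂ : c.arrs ⊆ d.arrs) (h₃ : c.reals ⊆ d.reals) : Frame d s s' :=
  ⟨fun y hy => h.var y (fun h => hy (h₁ h)), fun y hy => h.arr y (fun h => hy (h₂ h)),
    fun y hy => h.real y (fun h => hy (h₃ h))⟩

section Store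

variable (s : Store) (x y k a b i j i' j' : ℕ) (r : ℝ)

@[simp] theorem Store.setVar_var : (s.setVar x k).var y = if y = x then k else s.var y := rfl
@[simp] theorem Store.setVar_arr : (s.setVar x k).arr = s.arr := rfl
@[simp] theorem Store.setVar_real : (s.setVar x k).real = s.real := rfl
@[simp] theorem Store.setArr_var : (s.setArr a i j k).var = s.var := rfl
@[simp] theorem Store.setArr_real : (s.setArr a i j k).real = s.real := rfl
@[simp] theorem Store.setReal_var : (s.setReal a i j r).var = s.var := rfl
@[simp] theorem Store.setReal_arr : (s.setReal a i j r).arr = s.arr := rfl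

@[simp] theorem Store.setArr_arr_self : (s.setArr a i j k).arr a i' j' =
    if i' = i ∧ j' = j then k else s.arr a i' j' := by
  simp [Store.setArr]

@[simp] theorem Store.setReal_real_self : (s.setReal a i j r).real a i' j' =
    if i' = i ∧ j' = j then r else s.real a i' j' := by
  simp [Store.setReal]

@[simp] theorem Store.setArr_arr_of_ne (h : b ≠ a) : (s.setArr a i j k).arr b = s.arr b := by
  ext; simp [Store.setArr, h]

@[simp] theorem Store.setReal_real_of_ne (h : b ≠ a) : (s.setReal a i j r).real b = s.real b := by
  ext; simp [Store.setReal, h]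

@[simp] theorem Store.setReal_itemSet (m : ℕ) :
    (s.setReal b i' j' r).itemSet m a i = s.itemSet m a i := rfl

theorem Store.itemSet_congr {s s' : Store} {a : ℕ} (h : s'.arr a = s.arr a) (m i : ℕ) :
    s'.itemSet m a i = s.itemSet m a i := by
  simp [Store.itemSet, h]

@[simp] theorem Store.mem_itemSet {m : ℕ} (e : Fin m) : e ∈ s.itemSet m a i ↔ s.arr a i e ≠ 0 := by
  simp [Store.itemSet]

end Store

variable {n m : ℕ} {v : Valuations n m} {c d : Program} {s : Store} {Q Q' : Store → Prop}

/-- The footprint of a program is computed syntactically, so each use for a concrete program reduces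
to a non-membership settled by `decide` or `simp`. This carries facts past subprograms whose
specifications do not mention them. -/
theorem Exec.frame {s s' : Store} {t : ℕ} (h : Exec v c s t s') : Frame c s s' := by
  induction h with
  | skip s => exact .refl _ _
  | setVar s x e => exact ⟨fun y hy => by simp [Program.vars] at hy; simp [hy],
      fun _ _ => rfl, fun _ _ => rfl⟩
  | setArr s a i j e => exact ⟨fun _ _ => rfl,
      fun y hy => by simp [Program.arrs] at hy; simp [hy], fun _ _ => rfl⟩
  | setReal s a i j e => exact ⟨fun _ _ => rfl, fun _ _ => rfl,
      fun y hy => by simp [Program.reals] at hy; simp [hy]⟩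
  | query s a i j g b r hg => exact ⟨fun _ _ => rfl, fun _ _ => rfl,
      fun y hy => by simp [Program.reals] at hy; simp [hy]⟩
  | seq _ _ h₁ h₂ =>
    exact (h₁.mono (by simp [Program.vars]) (by simp [Program.arrs])
      (by simp [Program.reals])).trans (h₂.mono (by simp [Program.vars])
      (by simp [Program.arrs]) (by simp [Program.reals]))
  | iteTrue _ _ h =>
    exact h.mono (by simp [Program.vars]) (by simp [Program.arrs]) (by simp [Program.reals])
  | iteFalse _ _ h =>
    exact h.mono (by simp [Program.vars]) (by simp [Program.arrs]) (by simp [Program.reals])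
  | whileTrue _ _ _ h₁ h₂ => exact Frame.trans ⟨h₁.var, h₁.arr, h₁.real⟩ h₂
  | whileFalse _ => exact .refl _ _

/-- The program `c`, started in `s`, halts within its time bound in a store that satisfies `Q`. -/
def Runs {n m : ℕ} (v : Valuations n m) (c : Program) (s : Store) (Q : Store → Prop) : Prop :=
  ∃ t s', Exec v c s t s' ∧ t ≤ c.timeBound.eval (n + m) ∧ Q s'

theorem Runs.conseq (h : Runs v c s Q) (hQ : ∀ s', Frame c s s' → Q s' → Q' s') :
    Runs v c s Q' := by
  obtain ⟨t, s', h, ht, hq⟩ := h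
  exact ⟨t, s', h, ht, hQ s' h.frame hq⟩

theorem Runs.skip (h : Q s) : Runs v .skip s Q :=
  ⟨_, _, .skip s, by simp [Program.timeBound], h⟩

theorem Runs.setVar {x : ℕ} {e : NatExpr} (h : Q (s.setVar x (e.eval s))) :
    Runs v (.setVar x e) s Q :=
  ⟨_, _, .setVar s x e, by simp [Program.timeBound], h⟩

theorem Runs.setArr {a : ℕ} {i j e : NatExpr}
    (h : Q (s.setArr a (i.eval s) (j.eval s) (e.eval s))) : Runs v (.setArr a i j e) s Q :=
  ⟨_, _, .setArr s a i j e, by simp [Program.timeBound], h⟩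

theorem Runs.setReal {a : ℕ} {i j : NatExpr} {e : RealExpr}
    (h : Q (s.setReal a (i.eval s) (j.eval s) (e.eval s))) : Runs v (.setReal a i j e) s Q :=
  ⟨_, _, .setReal s a i j e, by simp [Program.timeBound], h⟩

theorem Runs.query {a b : ℕ} {i j g r : NatExpr} (hg : g.eval s < n)
    (h : Q (s.setReal a (i.eval s) (j.eval s) (v ⟨g.eval s, hg⟩ (s.itemSet m b (r.eval s))))) :
    Runs v (.query a i j g b r) s Q :=
  ⟨_, _, .query s a i j g b r hg, by simp [Program.timeBound]; omega, h⟩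

theorem Runs.seq (h : Runs v c s fun s' => Runs v d s' Q) : Runs v (.seq c d) s Q := by
  obtain ⟨t₁, s₁, h₁, ht₁, t₂, s₂, h₂, ht₂, hq⟩ := h
  exact ⟨_, _, .seq h₁ h₂, by simp [Program.timeBound]; omega, hq⟩

theorem Runs.ite {b : Cond} (hc : b.Holds s → Runs v c s Q) (hd : ¬ b.Holds s → Runs v d s Q) :
    Runs v (.ite b c d) s Q := by
  by_cases hb : b.Holds s
  · obtain ⟨t, s', h, ht, hq⟩ := hc hb
    exact ⟨_, _, .iteTrue hb h, by simp [Program.timeBound]; omega, hq⟩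
  · obtain ⟨t, s', h, ht, hq⟩ := hd hb
    exact ⟨_, _, .iteFalse hb h, by simp [Program.timeBound]; omega, hq⟩

/-- `for x = 0, …, e - 1 do c` -/
def forLt (x : ℕ) (e : NatExpr) (c : Program) : Program :=
  .seq (.setVar x (.const 0))
    (.while (.not (.natLe e (.var x))) (.seq c (.setVar x (.add (.var x) (.const 1)))))

/-- Induction on the number of remaining iterations; the extra summand `1` in the bound pays for the
last, failing test. -/
theorem exec_while_of_invariant {b : Cond} {N T : ℕ} (I : ℕ → Store → Prop)
    (hb : ∀ k s, I k s → (b.Holds s ↔ k < N))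
    (hc : ∀ k < N, ∀ s, I k s → ∃ t s', Exec v c s t s' ∧ t ≤ T ∧ I (k + 1) s')
    (k : ℕ) (hk : k ≤ N) (s : Store) (hs : I k s) :
    ∃ t s', Exec v (.while b c) s t s' ∧ t ≤ (N - k + 1) * (b.cost + 1 + T) ∧ I N s' := by
  obtain ⟨l, rfl⟩ := Nat.exists_eq_add_of_le hk
  induction l generalizing k s with
  | zero =>
    refine ⟨_, _, .whileFalse ((hb _ _ hs).not.2 (by simp)), ?_, hs⟩
    simp
  | succ l ih =>
    obtain ⟨t, s', h, ht, hs'⟩ := hc k (by omega) s hs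
    obtain ⟨t', s'', h', ht', hs''⟩ := ih (k + 1) s' hs' (by rw [Nat.add_right_comm]; exact hb)
      (by rw [Nat.add_right_comm]; exact hc) (by omega)
    refine ⟨_, _, .whileTrue ((hb _ _ hs).2 (by omega)) h h', ?_, by
      rwa [Nat.add_right_comm] at hs''⟩
    have h₁ : k + 1 + l - (k + 1) + 1 = l + 1 := by omega
    have h₂ : k + (l + 1) - k + 1 = l + 1 + 1 := by omega
    rw [h₁] at ht'
    rw [h₂, Nat.succ_mul]
    omega

/-- The counter is set outside the body, so the invariant must survive overwriting it; `e` is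
reevaluated before every iteration, hence `hN` covers all stores in the frame. The limit `n + m + 1`
matches the factor `X + 2` in `timeBound` and leaves room for loops over the columns `0, …, n`. -/
theorem Runs.forLt {x : ℕ} {e : NatExpr} {N : ℕ} (I : ℕ → Store → Prop)
    (hx : x ∉ c.vars) (hN : ∀ s', Frame (forLt x e c) s s' → e.eval s' = N)
    (hB : N ≤ n + m + 1) (hI : ∀ k s l, I k s → I k (s.setVar x l)) (h0 : I 0 s)
    (hc : ∀ k < N, ∀ s', Frame (FairDivision.forLt x e c) s s' → s'.var x = k → I k s' →
      Runs v c s' (I (k + 1)))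
    (hQ : ∀ s', Frame (FairDivision.forLt x e c) s s' → s'.var x = N → I N s' → Q s') :
    Runs v (forLt x e c) s Q := by
  have hF : Frame (FairDivision.forLt x e c) s (s.setVar x 0) :=
    ⟨fun y hy => by simp [FairDivision.forLt, Program.vars] at hy; simp [hy],
      fun _ _ => rfl, fun _ _ => rfl⟩
  obtain ⟨t, s', h, ht, hs', hF', hI'⟩ := exec_while_of_invariant (v := v)
    (b := .not (.natLe e (.var x))) (c := .seq c (.setVar x (.add (.var x) (.const 1))))
    -- The `4` is the cost of incrementing the counter.
    (N := N) (T := c.timeBound.eval (n + m) + 4)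
    (fun k s' => s'.var x = k ∧ Frame (FairDivision.forLt x e c) s s' ∧ I k s')
    (by
      rintro k s' ⟨hk, hF, -⟩
      simp [Cond.Holds, NatExpr.eval, hN s' hF, hk])
    (by
      rintro k hk s' ⟨hk', hF, hI'⟩
      obtain ⟨t, s'', h, ht, hI''⟩ := hc k hk s' hF hk' hI'
      have hF' : Frame (FairDivision.forLt x e c) s' s'' := h.frame.mono
        (by simp [FairDivision.forLt, Program.vars]) (by simp [FairDivision.forLt, Program.arrs])
        (by simp [FairDivision.forLt, Program.reals])
      refine ⟨_, _, .seq h (.setVar _ _ _), by simpa [NatExpr.cost] using ht, ?_, ?_,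
        hI _ _ _ hI''⟩
      · simp [NatExpr.eval, h.frame.var x hx, hk']
      · exact (hF.trans hF').trans ⟨fun y hy => by
          simp [FairDivision.forLt, Program.vars] at hy; simp [hy], fun _ _ => rfl,
          fun _ _ => rfl⟩)
    0 (Nat.zero_le _) (s.setVar x 0) ⟨by simp, hF, hI _ _ _ h0⟩
  refine ⟨_, _, .seq (.setVar _ _ _) h, ?_, hQ s' hF' hs' hI'⟩
  have h1 : (N - 0 + 1) ≤ n + m + 2 := by omega
  have h2 := Nat.mul_le_mul_right
    ((Cond.not (.natLe e (.var x))).cost + 1 + (c.timeBound.eval (n + m) + 4)) h1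
  have h3 := ht.trans h2
  simp only [FairDivision.forLt, Program.timeBound, NatExpr.cost, Polynomial.eval_add,
    Polynomial.eval_C, Polynomial.eval_mul, Polynomial.eval_X, Polynomial.eval_ofNat] at h3 ⊢
  rw [show (Cond.not (.natLe e (.var x))).cost + 1 + (Polynomial.eval (n + m) c.timeBound + 4) =
    (Cond.not (.natLe e (.var x))).cost + 1 + (Polynomial.eval (n + m) c.timeBound +
      (1 + 1 + 1 + 1)) from rfl] at h3
  omega

end FairDivision

namespace FairDivision

/-! ## Growing a tree of tight edges -/

/-- What the agent holding column `c` obtains from column `j`. -/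
def Store.payoff (s : Store) (c j : ℕ) : ℝ := s.real 1 (s.arr 2 0 c) j + s.real 2 0 j

/-- By how much the agent holding column `c` prefers it to column `j`. -/
def Store.slack (s : Store) (c j : ℕ) : ℝ := s.payoff c c - s.payoff c j

/-- Memory layout: row `0` of the natural arrays `2`, `3`, `4` holds, for each column, its holder,
its tree mark and its parent; the natural array `1` holds the bundles. The real array `1` holds
weights by agent and column, and row `0` of the real array `2` the prices. -/
def holderExpr (c : NatExpr) : NatExpr := .arr 2 (.const 0) c

def payoffExpr (c j : NatExpr) : RealExpr :=
  .add (.arr 1 (holderExpr c) j) (.arr 2 (.const 0) j)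

def slackExpr (c j : NatExpr) : RealExpr := .sub (payoffExpr c c) (payoffExpr c j)

@[simp] theorem slackExpr_eval (s : Store) (c j : NatExpr) :
    (slackExpr c j).eval s = s.slack (c.eval s) (j.eval s) := rfl

theorem Store.payoff_congr {s s' : Store} (h₁ : s'.arr 2 = s.arr 2) (h₂ : s'.real 1 = s.real 1)
    (h₃ : s'.real 2 = s.real 2) : s'.payoff = s.payoff := by
  ext c j; simp [Store.payoff, h₁, h₂, h₃]

theorem Store.slack_congr {s s' : Store} (h₁ : s'.arr 2 = s.arr 2) (h₂ : s'.real 1 = s.real 1)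
    (h₃ : s'.real 2 = s.real 2) : s'.slack = s.slack := by
  ext c j; simp [Store.slack, Store.payoff_congr h₁ h₂ h₃]

/-- Find the least slack from a column outside the tree to a column inside. -/
def minSlack : Program :=
  .seq (.setVar 5 (.const 0)) <|
    forLt 3 (.add (.var 2) (.const 1)) <| forLt 8 (.add (.var 2) (.const 1)) <|
      .ite (.and (.natEq (.arr 3 (.const 0) (.var 3)) (.const 0))
          (.and (.not (.natEq (.arr 3 (.const 0) (.var 8)) (.const 0)))
            (.not (.and (.not (.natEq (.var 5) (.const 0)))
              (.realLe (slackExpr (.var 6) (.var 7)) (slackExpr (.var 3) (.var 8)))))))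
        (.seq (.setVar 5 (.const 1)) (.seq (.setVar 6 (.var 3)) (.setVar 7 (.var 8))))
        .skip

/-- The variables `6` and `7` hold the least slack among the pairs satisfying `P`,
unless there is no such pair. -/
structure IsMinSlack (s s' : Store) (r : ℕ) (P : ℕ → ℕ → Prop) : Prop where
  none : s'.var 5 = 0 → ∀ c j, P c j → s.arr 3 0 c = 0 → s.arr 3 0 j = 0
  le : s'.var 5 ≠ 0 → s'.var 6 ≤ r ∧ s'.var 7 ≤ r
  out : s'.var 5 ≠ 0 → s.arr 3 0 (s'.var 6) = 0
  mem : s'.var 5 ≠ 0 → s.arr 3 0 (s'.var 7) ≠ 0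
  min : s'.var 5 ≠ 0 → ∀ c j, P c j → s.arr 3 0 c = 0 → s.arr 3 0 j ≠ 0 →
    s.slack (s'.var 6) (s'.var 7) ≤ s.slack c j

theorem IsMinSlack.mono {s s' : Store} {r : ℕ} {P P' : ℕ → ℕ → Prop} (h : IsMinSlack s s' r P)
    (hP : ∀ c j, P' c j → P c j) : IsMinSlack s s' r P' :=
  ⟨fun h' c j hcj => h.none h' c j (hP c j hcj), h.le, h.out, h.mem,
    fun h' c j hcj => h.min h' c j (hP c j hcj)⟩

variable {n m : ℕ} {v : Valuations n m} {s : Store}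

/-- Pairs are scanned lexicographically, whence the shape of the inner invariant. The flag in
variable `5` replaces an infinite initial minimum. -/
theorem runs_minSlack (hr : s.var 2 ≤ n) :
    Runs v minSlack s fun s' => IsMinSlack s s' (s.var 2) fun c j => c ≤ s.var 2 ∧ j ≤ s.var 2 := by
  refine .seq (.setVar ?_)
  refine .forLt (N := s.var 2 + 1)
    (fun k s' => IsMinSlack s s' (s.var 2) fun c j => c < k ∧ j ≤ s.var 2) (by decide)
    (fun s' hf => ?_) (by omega) (fun k s' l h => ⟨h.1, h.2, h.3, h.4, h.5⟩) ?_
    (fun k hk s' hf hk' hI => ?_) (fun s' hf hs' hI => ?_)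
  · simp [NatExpr.eval, hf.var 2 (by decide)]
  · constructor <;> simp [NatExpr.eval]
  · refine .forLt (N := s.var 2 + 1)
      (fun l s'' => IsMinSlack s s'' (s.var 2)
        fun c j => (c < k ∧ j ≤ s.var 2) ∨ (c = k ∧ j < l)) (by decide)
      (fun s'' hf' => ?_) (by omega) (fun k s' l h => ⟨h.1, h.2, h.3, h.4, h.5⟩)
      (hI.mono (by omega)) (fun l hl s'' hf' hl' hI' => ?_) (fun s'' hf' hs' hI' => ?_)
    · simp [NatExpr.eval, hf'.var 2 (by decide), hf.var 2 (by decide)]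
    · have e3 : s''.arr = s.arr := by
        ext a; rw [hf'.arr a List.not_mem_nil, hf.arr a List.not_mem_nil]; rfl
      have e4 : s''.real = s.real := by
        ext a; rw [hf'.real a List.not_mem_nil, hf.real a List.not_mem_nil]; rfl
      have hsl : s''.slack = s.slack := Store.slack_congr (by rw [e3]) (by rw [e4]) (by rw [e4])
      have hv3 : s''.var 3 = k := (hf'.var 3 (by decide)).trans hk'
      refine .ite (fun hb => ?_) (fun hb => ?_)
      · refine .seq (.setVar (.seq (.setVar (.setVar ?_))))
        simp only [Cond.Holds, NatExpr.eval, slackExpr_eval, hsl, hv3, hl', e3] at hb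
        constructor <;> simp only [Store.setVar_var, NatExpr.eval, hv3, hl'] <;> norm_num
        · omega
        · exact hb.1
        · exact hb.2.1
        · intro c j hcj hc hj
          by_cases hcj' : c = k ∧ j = l
          · simp [hcj']
          · have hb3 := hb.2.2
            by_cases h5 : s''.var 5 = 0
            · exact absurd (hI'.none h5 c j (by omega) hc) hj
            · simp [h5] at hb3
              exact hb3.le.trans (hI'.min h5 c j (by omega) hc hj)
      · refine .skip ?_
        simp only [Cond.Holds, NatExpr.eval, slackExpr_eval, hsl, hv3, hl', e3] at hb
        refine ⟨fun h5 c j hcj hc => ?_, hI'.le, hI'.out, hI'.mem, fun h5 c j hcj hc hj => ?_⟩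
        · by_contra hj
          have : c = k ∧ j = l := by
            by_contra hcj'
            exact hj (hI'.none h5 c j (by omega) hc)
          obtain ⟨rfl, rfl⟩ := this
          exact hb ⟨hc, hj, fun h => h.1 h5⟩
        · by_cases hcj' : c = k ∧ j = l
          · obtain ⟨rfl, rfl⟩ := hcj'
            by_contra hlt
            exact hb ⟨hc, hj, fun h => hlt h.2⟩
          · exact hI'.min h5 c j (by omega) hc hj
    · exact hI'.mono (by omega)
  · exact hI.mono (by omega)

end FairDivision

/-! ### Tight trees and their extension by one column -/

namespace FairDivision

/-- The columns in `S` form a tree with root `r`, in which the column `par c` is as good as `c` for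
the agent holding `c`; `sl c j` is the amount by which this agent prefers `c` to `j`. -/
structure IsTightTree (r : ℕ) (sl : ℕ → ℕ → ℝ) (S : ℕ → Prop) (par ord : ℕ → ℕ) : Prop where
  root : S r
  ord_root : ord r = 0
  ord_le : ∀ c ≤ r, ord c ≤ r
  par_le : ∀ c < r, S c → par c ≤ r
  par_mem : ∀ c < r, S c → S (par c)
  ord_par : ∀ c < r, S c → ord (par c) < ord c
  tight : ∀ c < r, S c → sl c (par c) = 0
  mem_nonneg : ∀ c < r, S c → ∀ j ≤ r, 0 ≤ sl c j
  out_nonneg : ∀ c < r, ¬ S c → ∀ j < r, ¬ S j → 0 ≤ sl c j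
  cross_nonneg : ∀ b < r, S b → ∀ c < r, ¬ S c → ∀ j ≤ r, S j → 0 ≤ sl c j

-- Prices outside the tree drop by `δ = sl b i`. Slacks from outside into the tree lose `δ`, remain
-- nonnegative by minimality, and the one from `b` to `i` becomes zero; slacks from the tree to the
-- outside gain `δ`; the others do not change. While the tree is just the root, `δ` may be negative,
-- but no constrained slack suffers; as soon as there is another member, `cross_nonneg` gives `δ ≥
-- 0`.
open Classical in
theorem IsTightTree.insert {r t : ℕ} {sl sl' : ℕ → ℕ → ℝ} {S : ℕ → Prop} {par ord : ℕ → ℕ}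
    (h : IsTightTree r sl S par ord) (ht : t ≤ r) (hord : ∀ c ≤ r, S c → ord c < t)
    {b i : ℕ} (hb : b ≤ r) (hbS : ¬ S b) (hi : i ≤ r) (hiS : S i)
    (hmin : ∀ c j, c ≤ r → j ≤ r → ¬ S c → S j → sl b i ≤ sl c j)
    (hsl : ∀ c j, c ≤ r → j ≤ r →
      sl' c j = sl c j - (if S c then 0 else sl b i) + (if S j then 0 else sl b i)) :
    IsTightTree r sl' (fun c => S c ∨ c = b) (Function.update par b i)
      (Function.update ord b t) := by
  have hrb : r ≠ b := fun e => hbS (e ▸ h.root)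
  have hne : ∀ {c}, S c → c ≠ b := fun hc e => hbS (e ▸ hc)
  have hlt : ∀ {c}, c ≤ r → ¬ S c → c < r := fun hc hS =>
    lt_of_le_of_ne hc fun e => hS (e ▸ h.root)
  refine ⟨.inl h.root, by simp [hrb, h.ord_root], ?_, ?_, ?_, ?_, ?_, ?_, ?_, ?_⟩
  · intro c hc
    by_cases e : c = b
    · simp [e, ht]
    · simp [e, h.ord_le c hc]
  · rintro c hc (hS | rfl)
    · simpa [hne hS] using h.par_le c hc hS
    · simpa using hi
  · rintro c hc (hS | rfl)
    · simpa [hne hS] using Or.inl (h.par_mem c hc hS)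
    · simpa using Or.inl hiS
  · rintro c hc (hS | rfl)
    · simpa [hne hS, hne (h.par_mem c hc hS)] using h.ord_par c hc hS
    · simpa [hne hiS] using hord i hi hiS
  · rintro c hc (hS | rfl)
    · simp [hne hS, hsl c _ hc.le (h.par_le c hc hS), hS, h.par_mem c hc hS, h.tight c hc hS]
    · simp [hsl c _ hc.le hi, hbS, hiS]
  · rintro c hc (hS | rfl) j hj
    · rw [hsl c j hc.le hj]
      have h1 := h.mem_nonneg c hc hS j hj
      have h2 := h.cross_nonneg c hc hS b (hlt hb hbS) hbS i hi hiS
      simp only [hS, if_true]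
      split_ifs <;> linarith
    · rw [hsl c j hc.le hj]
      by_cases hjS : S j
      · simpa [hjS, hbS] using hmin c j hc.le hj hbS hjS
      · simpa [hjS, hbS] using h.out_nonneg c hc hbS j (hlt hj hjS) hjS
  · intro c hc hS j hj hjS
    push Not at hS hjS
    simpa [hsl c j hc.le hj.le, hS.1, hjS.1] using h.out_nonneg c hc hS.1 j hj hjS.1
  · rintro - - - c hc hS j hj (hjS | rfl)
    · push Not at hS
      simpa [hsl c j hc.le hj, hS.1, hjS] using hmin c j hc.le hj hS.1 hjS
    · push Not at hS
      simpa [hsl c j hc.le hj, hS.1, hbS] using h.out_nonneg c hc hS.1 j (hlt hj hbS) hbS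

/-- The amount is read from a separate cell because the slack that defines it changes with the
prices. It can be negative in the first round, and the prices then rise. -/
def lowerPrices : Program :=
  forLt 3 (.add (.var 2) (.const 1)) <|
    .ite (.natEq (.arr 3 (.const 0) (.var 3)) (.const 0))
      (.setReal 2 (.const 0) (.var 3)
        (.sub (.arr 2 (.const 0) (.var 3)) (.arr 4 (.const 0) (.const 0)))) .skip

/-- Add one column to the tree. -/
def extendTree : Program :=
  .seq minSlack <|
  .seq (.setReal 4 (.const 0) (.const 0) (slackExpr (.var 6) (.var 7))) <|
  .seq lowerPrices <|
  .seq (.setArr 3 (.const 0) (.var 6) (.const 1)) <|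
    .setArr 4 (.const 0) (.var 6) (.var 7)

/-- Find prices for which the columns `0, …, r` form a tight tree with root `r`, where `r` is the
value of the variable `2`. -/
def growTree : Program :=
  .seq (forLt 3 (.add (.var 2) (.const 1)) <| .setArr 3 (.const 0) (.var 3) (.const 0)) <|
  .seq (.setArr 3 (.const 0) (.var 2) (.const 1)) <|
    forLt 4 (.var 2) extendTree

variable {n m : ℕ} {v : Valuations n m} {s : Store}

theorem runs_lowerPrices (hr : s.var 2 ≤ n) :
    Runs v lowerPrices s fun s' => ∀ c ≤ s.var 2,
      s'.real 2 0 c = s.real 2 0 c - if s.arr 3 0 c ≠ 0 then 0 else s.real 4 0 0 := by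
  refine .forLt (N := s.var 2 + 1) (fun k s' => ∀ c ≤ s.var 2,
      s'.real 2 0 c = s.real 2 0 c - if s.arr 3 0 c ≠ 0 ∨ k ≤ c then 0 else s.real 4 0 0)
    (by decide) (fun s' hf => ?_) (by omega) (fun k s' l h => h) (by simp)
    (fun k hk s' hf hk' hI => ?_) (fun s' hf hs' hI c hc => ?_)
  · simp [NatExpr.eval, hf.var 2 (by decide)]
  · have e3 := hf.arr 3 (by simp [forLt, Program.arrs])
    have e4 := hf.real 4 (by simp [forLt, Program.reals])
    refine .ite (fun hb => .setReal ?_) (fun hb => .skip ?_)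
    · simp only [Cond.Holds, NatExpr.eval, hk', e3] at hb
      intro c hc
      simp only [NatExpr.eval, RealExpr.eval, hk', Store.setReal_real_self, true_and, e4]
      rw [hI c hc]
      split_ifs with h1 h2 h3 h4 h5 <;> first | rfl | (subst h1; simp_all) | (exfalso; omega)
    · simp only [Cond.Holds, NatExpr.eval, hk', e3] at hb
      intro c hc
      rw [hI c hc]
      by_cases hck : c = k
      · subst hck; simp [hb]
      · congr 2
        apply propext
        omega
  · rw [hI c hc]
    congr 2
    apply propext
    omega

/-- The marked columns are `t` columns that form a tight tree with root `r`. -/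
def HasTree (s : Store) (r t : ℕ) : Prop :=
  ∃ ord, IsTightTree r s.slack (fun c => s.arr 3 0 c ≠ 0) (s.arr 4 0) ord ∧
    (∀ c ≤ r, s.arr 3 0 c ≠ 0 → ord c < t) ∧
    ((Finset.range (r + 1)).filter fun c => s.arr 3 0 c ≠ 0).card = t

theorem runs_extendTree {t : ℕ} (hr : s.var 2 ≤ n) (ht : t ≤ s.var 2) (h : HasTree s (s.var 2) t) :
    Runs v extendTree s fun s' => HasTree s' (s.var 2) (t + 1) := by
  obtain ⟨ord, hT, hord, hcard⟩ := h
  set r := s.var 2 with hrdef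
  -- Only `t ≤ r` of the `r + 1` columns are marked.
  obtain ⟨c₀, hc₀, hS₀⟩ : ∃ c ≤ r, s.arr 3 0 c = 0 := by
    by_contra! hall
    rw [Finset.filter_true_of_mem fun c hc => hall c (by simpa [Nat.lt_succ_iff] using hc)] at hcard
    simp at hcard
    omega
  refine .seq ((runs_minSlack hr).conseq fun s₁ hf₁ h₁ => .seq (.setReal (.seq
    ((runs_lowerPrices (by simpa [hf₁.var 2 (by decide)] using hr)).conseq
      fun s₂ hf₂ h₂ => .seq (.setArr (.setArr ?_))))))
  have a₁ : s₁.arr = s.arr := by ext a; rw [hf₁.arr a List.not_mem_nil]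
  have r₁ : s₁.real = s.real := by ext a; rw [hf₁.real a List.not_mem_nil]
  have a₂ : s₂.arr = s.arr := by
    ext a; rw [hf₂.arr a List.not_mem_nil, Store.setReal_arr, a₁]
  have w₂ : s₂.real 1 = s.real 1 := by
    rw [hf₂.real 1 (by decide), Store.setReal_real_of_ne _ _ _ _ _ _ (by decide), r₁]
  have v2 : s₁.var 2 = r := hf₁.var 2 (by decide)
  have v6 : s₂.var 6 = s₁.var 6 := hf₂.var 6 (by decide)
  have v7 : s₂.var 7 = s₁.var 7 := hf₂.var 7 (by decide)
  have sl₁ : s₁.slack = s.slack := Store.slack_congr (by rw [a₁]) (by rw [r₁]) (by rw [r₁])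
  have h5 : s₁.var 5 ≠ 0 := fun h5 => hT.root (h₁.none h5 c₀ r ⟨hc₀, le_rfl⟩ hS₀)
  have Q₂ : ∀ c ≤ r, s₂.real 2 0 c = s.real 2 0 c -
      if s.arr 3 0 c ≠ 0 then 0 else s.slack (s₁.var 6) (s₁.var 7) := by
    intro c hc
    have := h₂ c (by simpa [v2] using hc)
    simpa [r₁, a₁, sl₁, NatExpr.eval] using this
  obtain ⟨hb, hi⟩ := h₁.le h5
  have hbS := h₁.out h5
  have hiS := h₁.mem h5
  have hmin := h₁.min h5
  simp only [NatExpr.eval, v6, v7, Store.setArr_var]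
  generalize s₁.var 6 = b at *
  generalize s₁.var 7 = i at *
  set s₃ := (s₂.setArr 3 0 b 1).setArr 4 0 b i with hs₃
  have S₃ : ∀ c, s₃.arr 3 0 c ≠ 0 ↔ s.arr 3 0 c ≠ 0 ∨ c = b := by
    intro c
    rw [hs₃, Store.setArr_arr_of_ne _ _ _ _ _ _ (by decide), Store.setArr_arr_self, a₂]
    by_cases e : c = b <;> simp [e]
  have P₃ : s₃.arr 4 0 = Function.update (s.arr 4 0) b i := by
    ext c
    rw [hs₃, Store.setArr_arr_self, Store.setArr_arr_of_ne _ _ _ _ _ _ (by decide), a₂]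
    simp [Function.update_apply]
  have Q₃ : ∀ c ≤ r, s₃.real 2 0 c = s.real 2 0 c -
      if s.arr 3 0 c ≠ 0 then 0 else s.slack b i := by
    intro c hc
    simpa [hs₃] using Q₂ c hc
  have sl₃ : ∀ c j, c ≤ r → j ≤ r → s₃.slack c j = s.slack c j -
      (if s.arr 3 0 c ≠ 0 then 0 else s.slack b i) +
      (if s.arr 3 0 j ≠ 0 then 0 else s.slack b i) := by
    intro c j hc hj
    have e1 : s₃.arr 2 = s.arr 2 := by simp [hs₃, a₂]
    have e2 : s₃.real 1 = s.real 1 := by simp [hs₃, w₂]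
    rw [Store.slack, Store.payoff, Store.payoff, e1, e2, Q₃ c hc, Q₃ j hj]
    simp only [Store.slack, Store.payoff]
    ring
  -- The order of a column is the number of columns marked before it, so it exceeds that of its
  -- parent.
  refine ⟨Function.update ord b t, ?_, ?_, ?_⟩
  · rw [P₃, funext fun c => propext (S₃ c)]
    exact hT.insert ht hord hb (by simpa using hbS) hi hiS
      (fun c j hc hj hcS hjS => hmin c j ⟨hc, hj⟩ (by simpa using hcS) hjS)
      (fun c j hc hj => by rw [sl₃ c j hc hj]; congr)
  · intro c hc hS
    by_cases e : c = b
    · simp [e]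
    · have := hord c hc (((S₃ c).1 hS).resolve_right e)
      simp [e]
      omega
  · rw [Finset.filter_congr fun c _ => S₃ c, Finset.filter_or, Finset.card_union_of_disjoint, hcard,
      Finset.filter_eq', if_pos (by simpa [Nat.lt_succ_iff] using hb), Finset.card_singleton]
    refine Finset.disjoint_filter.2 fun c _ hS e => hS (e ▸ hbS)

/-- All columns up to `r` form a tight tree. -/
theorem runs_growTree (hr : s.var 2 ≤ n)
    (h : ∀ c < s.var 2, ∀ j < s.var 2, 0 ≤ s.slack c j) :
    Runs v growTree s fun s' => ∃ ord,
      IsTightTree (s.var 2) s'.slack (fun c => c ≤ s.var 2) (s'.arr 4 0) ord := by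
  refine .seq (.conseq (.forLt (N := s.var 2 + 1) (fun k s' => ∀ c < k, s'.arr 3 0 c = 0)
    (by decide) (fun s' hf => ?_) (by omega) (fun k s' l h => h) (by simp)
    (fun k hk s' hf hk' hI => .setArr ?_) (fun s' hf _ h => h)) fun s₁ hf₁ h₁ => .seq (.setArr ?_))
  · simp [NatExpr.eval, hf.var 2 (by decide)]
  · intro c hc
    simp only [NatExpr.eval, hk', Store.setArr_arr_self, true_and]
    split_ifs
    · rfl
    · exact hI c (by omega)
  · have v2 : s₁.var 2 = s.var 2 := hf₁.var 2 (by decide)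
    have hsl : s₁.slack = s.slack := Store.slack_congr (hf₁.arr 2 (by decide))
      (hf₁.real 1 (by decide)) (hf₁.real 2 (by decide))
    have S₁ : ∀ c ≤ s.var 2, (s₁.setArr 3 0 (s.var 2) 1).arr 3 0 c ≠ 0 ↔ c = s.var 2 := by
      intro c hc
      rw [Store.setArr_arr_self, h₁ c (by omega)]
      simp
    refine .forLt (N := s.var 2) (fun k s' => HasTree s' (s.var 2) (k + 1))
      (by decide) (fun s' hf => ?_) (by omega) (fun k s' l h => h) ?_
      (fun k hk s' hf hk' hI => ?_) (fun s' hf _ h => ?_)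
    · simp [NatExpr.eval, hf.var 2 (by decide), v2]
    · simp only [NatExpr.eval, v2]
      -- Only the root is marked at first, so every condition about members below it is vacuous,
      -- `cross_nonneg` included.
      refine ⟨fun _ => 0, ⟨by simp, rfl, by simp, ?_, ?_, ?_, ?_, ?_, ?_, ?_⟩, by simp, ?_⟩
      all_goals try (intro c hc hS; exact absurd ((S₁ c hc.le).1 hS) hc.ne)
      · intro c hc _ j hj _
        have := h c hc j hj
        rwa [← hsl] at this
      · rw [Finset.filter_congr fun c hc => S₁ c (by simpa [Nat.lt_succ_iff] using hc),
          Finset.filter_eq', if_pos (by simp), Finset.card_singleton]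
    · have v2' : s'.var 2 = s.var 2 := by
        rw [hf.var 2 (by decide)]; exact v2
      have := runs_extendTree (v := v) (s := s') (t := k + 1) (by omega) (by omega)
        (by rwa [v2'])
      rwa [v2'] at this
    · obtain ⟨ord, hT, -, hcard⟩ := h
      have hall : ∀ c ≤ s.var 2, s'.arr 3 0 c ≠ 0 := by
        intro c hc
        exact Finset.filter_card_eq (hcard.trans (Finset.card_range _).symm) c
          (by simpa [Nat.lt_succ_iff] using hc)
      exact ⟨ord, le_rfl, hT.ord_root, hT.ord_le, fun c hc _ => hT.par_le c hc (hall c hc.le),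
        fun c hc _ => hT.par_le c hc (hall c hc.le), fun c hc _ => hT.ord_par c hc (hall c hc.le),
        fun c hc _ => hT.tight c hc (hall c hc.le), fun c hc _ => hT.mem_nonneg c hc (hall c hc.le),
        fun c hc h => absurd hc.le h, fun b hb _ => fun c hc h => absurd hc.le h⟩

end FairDivision

namespace FairDivision

/-! ## Maximum weight matchings with prices -/

/-- Find the best column for the agent holding column `r`. -/
def chooseColumn : Program :=
  .seq (.setVar 6 (.const 0)) <|
    forLt 8 (.add (.var 2) (.const 1)) <|
      .ite (.realLe (payoffExpr (.var 2) (.var 8)) (payoffExpr (.var 2) (.var 6))) .skip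
        (.setVar 6 (.var 8))

/-- Reassign the columns along the path from column `x` to the root `r`,
where `x` is the value of the variable `6`. -/
def followPath : Program :=
  forLt 4 (.add (.var 2) (.const 1)) <|
    .ite (.natEq (.var 6) (.var 2)) .skip <|
      .seq (.setVar 7 (holderExpr (.var 6))) <|
      .seq (.setArr 2 (.const 0) (.var 6) (holderExpr (.var 2))) <|
      .seq (.setArr 2 (.const 0) (.var 2) (.var 7)) <|
        .setVar 6 (.arr 4 (.const 0) (.var 6))

/-- The columns `0, …, r - 1` are held by the agents `0, …, r - 1`. -/
def Store.HoldersBelow (s : Store) (r : ℕ) : Prop :=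
  (∀ c < r, s.arr 2 0 c < r) ∧ ∀ c < r, ∀ d < r, s.arr 2 0 c = s.arr 2 0 d → c = d

variable {n m : ℕ} {v : Valuations n m} {s : Store}

theorem runs_chooseColumn (hr : s.var 2 ≤ n) :
    Runs v chooseColumn s fun s' => s'.var 6 ≤ s.var 2 ∧
      ∀ j ≤ s.var 2, s.payoff (s.var 2) j ≤ s.payoff (s.var 2) (s'.var 6) := by
  refine .seq (.setVar (.forLt (N := s.var 2 + 1) (fun k s' => s'.var 6 ≤ s.var 2 ∧
      ∀ j < k, s.payoff (s.var 2) j ≤ s.payoff (s.var 2) (s'.var 6))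
    (by decide) (fun s' hf => ?_) (by omega) (fun k s' l h => h) ?_
    (fun k hk s' hf hk' hI => ?_) (fun s' hf hs' hI => ⟨hI.1, fun j hj => hI.2 j (by omega)⟩)))
  · simp [NatExpr.eval, hf.var 2 (by decide)]
  · simp [NatExpr.eval]
  · have e : s'.payoff = s.payoff := Store.payoff_congr (hf.arr 2 (by decide))
      (hf.real 1 (by decide)) (hf.real 2 (by decide))
    have v2 : s'.var 2 = s.var 2 := hf.var 2 (by decide)
    have hb : (Cond.realLe (payoffExpr (.var 2) (.var 8)) (payoffExpr (.var 2) (.var 6))).Holds s' ↔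
        s.payoff (s.var 2) k ≤ s.payoff (s.var 2) (s'.var 6) := by
      rw [← e, ← v2, ← hk']; rfl
    refine .ite (fun h => .skip ⟨hI.1, fun j hj => ?_⟩)
      (fun h => .setVar ⟨by simp [NatExpr.eval, hk']; omega, fun j hj => ?_⟩)
    · rcases Nat.lt_succ_iff_lt_or_eq.1 hj with hj | rfl
      · exact hI.2 j hj
      · exact hb.1 h
    · simp only [Store.setVar_var, NatExpr.eval, hk', if_true]
      rcases Nat.lt_succ_iff_lt_or_eq.1 hj with hj | rfl
      · exact (hI.2 j hj).trans (le_of_not_ge (mt hb.2 h))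
      · exact le_rfl

/-- Each round swaps the holders of `x` and of the root. The agent coming from the root gets its
best column `x`; the one sent to the root is indifferent between `x` and its parent, which becomes
the next target. Columns of order at most that of the target still have their original holders, so
tightness in the original tree applies. Orders decrease strictly, so `r + 1` rounds suffice. -/
theorem runs_followPath {ord : ℕ → ℕ} (hr : s.var 2 ≤ n) (hH : s.HoldersBelow (s.var 2 + 1))
    (hT : IsTightTree (s.var 2) s.slack (fun c => c ≤ s.var 2) (s.arr 4 0) ord)
    (h6 : s.var 6 ≤ s.var 2)
    (hx : ∀ j ≤ s.var 2, s.payoff (s.var 2) j ≤ s.payoff (s.var 2) (s.var 6)) :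
    Runs v followPath s fun s' => s'.HoldersBelow (s.var 2 + 1) ∧
      ∀ c ≤ s.var 2, ∀ j ≤ s.var 2, 0 ≤ s'.slack c j := by
  refine .forLt (N := s.var 2 + 1) (fun k s' => s'.var 6 ≤ s.var 2 ∧
      (ord (s'.var 6) + k ≤ s.var 2 ∨ s'.var 6 = s.var 2) ∧ s'.HoldersBelow (s.var 2 + 1) ∧
      (∀ c < s.var 2, ∀ j ≤ s.var 2, 0 ≤ s'.slack c j) ∧
      (∀ j ≤ s.var 2, s'.payoff (s.var 2) j ≤ s'.payoff (s.var 2) (s'.var 6)) ∧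
      ∀ c < s.var 2, ord c ≤ ord (s'.var 6) → s'.arr 2 0 c = s.arr 2 0 c)
    (by decide) (fun s' hf => ?_) (by omega) (fun k s' l h => h) ?_
    (fun k hk s' hf hk' hI => ?_) (fun s' hf hs' hI => ?_)
  · simp [NatExpr.eval, hf.var 2 (by decide)]
  · exact ⟨h6, .inl (by simpa using hT.ord_le _ h6), hH,
      fun c hc => hT.mem_nonneg c hc hc.le, hx, fun _ _ _ => rfl⟩
  · obtain ⟨hx, hord, hH', hsl, hbest, hsame⟩ := hI
    have v2 : s'.var 2 = s.var 2 := hf.var 2 (by decide)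
    have a4 : s'.arr 4 = s.arr 4 := hf.arr 4 (by decide)
    have r1 : s'.real 1 = s.real 1 := hf.real 1 (by decide)
    have r2 : s'.real 2 = s.real 2 := hf.real 2 (by decide)
    refine .ite (fun h => .skip ?_) (fun h => ?_)
    · simp only [Cond.Holds, NatExpr.eval, v2] at h
      exact ⟨hx, .inr h, hH', hsl, hbest, hsame⟩
    · simp only [Cond.Holds, NatExpr.eval, v2] at h
      refine .seq (.setVar (.seq (.setArr (.seq (.setArr (.setVar ?_))))))
      simp only [NatExpr.eval, holderExpr, Store.setVar_var, Store.setArr_var, v2, Store.setVar_arr]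
      norm_num
      rw [a4]
      generalize s'.var 6 = x at *
      set r := s.var 2
      have hxr : x < r := by omega
      set s₁ := (((s'.setVar 7 (s'.arr 2 0 x)).setArr 2 0 x (s'.arr 2 0 r)).setArr 2 0 r
        (s'.arr 2 0 x)).setVar 6 (s.arr 4 0 x) with hs₁
      have hold₁ : ∀ c, s₁.arr 2 0 c = if c = r then s'.arr 2 0 x else
          if c = x then s'.arr 2 0 r else s'.arr 2 0 c := by
        intro c
        rw [hs₁]; simp
      have pay₁ : ∀ c j, s₁.payoff c j = if c = r then s'.payoff x j else
          if c = x then s'.payoff r j else s'.payoff c j := by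
        intro c j
        rw [Store.payoff, hold₁]
        simp only [hs₁, Store.setVar_real, Store.setArr_real]
        split_ifs <;> rfl
      have hpar := hT.par_le x hxr hxr.le
      have hopar := hT.ord_par x hxr hxr.le
      refine ⟨hpar, ?_, ⟨fun c hc => ?_, fun c hc d hd => ?_⟩, fun c hc j hj => ?_,
        fun j hj => ?_, fun c hc hoc => ?_⟩
      · left; omega
      · rw [hold₁]
        have := hH'.1
        split_ifs <;> apply this <;> omega
      · rw [hold₁, hold₁]
        have := hH'.2
        split_ifs <;> intro e <;> have := this _ (by omega) _ (by omega) e <;> omega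
      · rw [Store.slack, pay₁, pay₁, if_neg hc.ne, if_neg hc.ne]
        split_ifs with e
        · subst e
          exact sub_nonneg.2 (hbest j hj)
        · exact hsl c hc j hj
      · rw [pay₁, pay₁, if_pos rfl, if_pos rfl]
        have hp : ∀ j, s'.payoff x j = s.payoff x j := fun j => by
          simp only [Store.payoff, hsame x hxr le_rfl, r1, r2]
        rw [hp, hp]
        have h1 := hT.tight x hxr hxr.le
        have h2 := hT.mem_nonneg x hxr hxr.le j hj
        simp only [Store.slack] at h1 h2
        linarith
      · rw [if_neg hc.ne, if_neg (by rintro rfl; omega)]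
        exact hsame c hc (by omega)
  · obtain ⟨hx, hord, hH', hsl, hbest, hsame⟩ := hI
    refine ⟨hH', fun c hc j hj => ?_⟩
    rcases hc.lt_or_eq with hc | rfl
    · exact hsl c hc j hj
    · have : s'.var 6 = s.var 2 := by omega
      rw [this] at hbest
      exact sub_nonneg.2 (hbest j hj)

/-- Find a matching of the agents `0, …, n - 1` to the columns `0, …, n - 1` and supporting
prices. -/
def matchColumns : Program :=
  forLt 2 (.var 0) <|
    .seq (.setArr 2 (.const 0) (.var 2) (.var 2)) <|
    .seq growTree <| .seq chooseColumn followPath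

/-- The Hungarian method, with one new agent and column per round. The new agent starts on the new
column, the root, where nothing is required of its slack; the tree lets it move to its best column
while the agents on the path shift without loss. -/
theorem runs_matchColumns (hn : s.var 0 = n) :
    Runs v matchColumns s fun s' => s'.var 2 = n ∧ s'.HoldersBelow n ∧
      ∀ c < n, ∀ j < n, 0 ≤ s'.slack c j := by
  refine .forLt (N := n) (fun k s' => s'.HoldersBelow k ∧
      ∀ c < k, ∀ j < k, 0 ≤ s'.slack c j)
    (by decide) (fun s' hf => ?_) (by omega) (fun k s' l h => h) ?_
    (fun k hk s' hf hk' hI => ?_) (fun s' hf hs' hI => ⟨hs', hI⟩)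
  · simp [NatExpr.eval, hf.var 0 (by decide), hn]
  · simp [Store.HoldersBelow]
  · obtain ⟨hH, hsl⟩ := hI
    refine .seq (.setArr ?_)
    simp only [NatExpr.eval, hk']
    set s₀ := s'.setArr 2 0 k k with hs₀
    have hold₀ : ∀ c, s₀.arr 2 0 c = if c = k then k else s'.arr 2 0 c := by
      intro c
      rw [hs₀]; simp
    have hsl₀ : ∀ c < k, ∀ j < k, 0 ≤ s₀.slack c j := by
      intro c hc j hj
      have : s₀.slack c j = s'.slack c j := by
        simp only [Store.slack, Store.payoff, hold₀, if_neg hc.ne]; rfl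
      rw [this]
      exact hsl c hc j hj
    have hH₀ : s₀.HoldersBelow (k + 1) := by
      refine ⟨fun c hc => ?_, fun c hc d hd => ?_⟩
      · rw [hold₀]
        have := hH.1 c
        split_ifs <;> omega
      · rw [hold₀, hold₀]
        have h1 := hH.1 c
        have h2 := hH.1 d
        have h3 := hH.2 c
        split_ifs <;> intro e <;> first | omega | exact h3 (by omega) d (by omega) e
    have v2 : s₀.var 2 = k := hk'
    refine .seq ((runs_growTree (by omega) (by rwa [v2])).conseq ?_)
    rintro s₁ hf₁ ⟨ord, hT⟩
    have v2₁ : s₁.var 2 = k := by rw [hf₁.var 2 (by decide), v2]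
    refine .seq ((runs_chooseColumn (by omega)).conseq ?_)
    rintro s₂ hf₂ ⟨h6, hbest⟩
    have v2₂ : s₂.var 2 = k := by rw [hf₂.var 2 (by decide), v2₁]
    have hp₂ : s₂.payoff = s₁.payoff := Store.payoff_congr (hf₂.arr 2 (by decide))
      (hf₂.real 1 (by decide)) (hf₂.real 2 (by decide))
    have hsl₂ : s₂.slack = s₁.slack := Store.slack_congr (hf₂.arr 2 (by decide))
      (hf₂.real 1 (by decide)) (hf₂.real 2 (by decide))
    have a2₂ : s₂.arr 2 = s₀.arr 2 := (hf₂.arr 2 (by decide)).trans (hf₁.arr 2 (by decide))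
    refine (runs_followPath (ord := ord) (by omega) ?_ ?_ (by omega) ?_).conseq
      fun s₃ _ h₃ => ?_
    · rw [v2₂, Store.HoldersBelow, a2₂]
      exact hH₀
    · rw [hsl₂, hf₂.arr 4 (by decide), v2₂]
      rwa [v2] at hT
    · rw [v2₂, hp₂]
      rwa [v2₁] at hbest
    · rw [v2₂] at h₃
      exact ⟨h₃.1, fun c hc j hj => h₃.2 c (by omega) j (by omega)⟩

end FairDivision

/-! ### Supporting prices, bounds on them, and bundles with envy at most one -/

namespace FairDivision

theorem Store.HoldersBelow.exists_perm {s : Store} {n : ℕ} (h : s.HoldersBelow n) :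
    ∃ σ : Equiv.Perm (Fin n), ∀ c : Fin n, s.arr 2 0 c = σ c := by
  let f : Fin n → Fin n := fun c => ⟨s.arr 2 0 c, h.1 c c.2⟩
  have hf : Function.Injective f := fun c d e =>
    Fin.ext (h.2 c c.2 d d.2 (by simpa [f] using e))
  exact ⟨Equiv.ofBijective f (Finite.injective_iff_bijective.1 hf), fun c => rfl⟩

/-- A maximum weight perfect matching is supported by prices. -/
theorem exists_supporting_prices {n : ℕ} (w : Fin n → Fin n → ℝ) :
    ∃ (π : Equiv.Perm (Fin n)) (q : Fin n → ℝ), ∀ i j, w i j + q j ≤ w i (π i) + q (π i) := by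
  -- The matching program serves as the existence proof: it is run with the weights preloaded, no
  -- items and dummy valuations.
  let s : Store :=
    { var := fun _ => n
      arr := fun _ _ _ => 0
      real := fun _ i j => if h : i < n ∧ j < n then w ⟨i, h.1⟩ ⟨j, h.2⟩ else 0 }
  obtain ⟨t, s', h, -, -, hH, hsl⟩ := runs_matchColumns (m := 0) (v := fun _ _ => 0) (s := s)
    (n := n) rfl
  obtain ⟨σ, hσ⟩ := hH.exists_perm
  refine ⟨σ.symm, fun c => s'.real 2 0 c, fun i j => ?_⟩
  have := hsl (σ.symm i) (σ.symm i).2 j j.2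
  simp only [Store.slack, Store.payoff, hσ, h.frame.real 1 (by decide), Equiv.apply_symm_apply] at this
  simpa [s] using this

theorem sum_fin_eq (n : ℕ) : ∑ i : Fin n, (i : ℝ) = (n : ℝ) * ((n : ℝ) - 1) / 2 := by
  rw [Fin.sum_univ_eq_sum_range (fun i => (i : ℝ))]
  induction n with
  | zero => simp
  | succ n ih => rw [Finset.sum_range_succ, ih]; push_cast; ring

/-- Prices of which the consecutive ones, in increasing order, differ by at most `k`. -/
theorem bounds_of_gap_le {n : ℕ} {p : Fin n → ℝ} {k : ℝ} (hp : ∃ i, p i ≤ 0) (hk : 0 ≤ k)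
    (hgap : ∀ θ, 0 ≤ θ → (∃ i, θ < p i) → ∃ i, θ < p i ∧ p i ≤ θ + k) :
    (∀ i, p i ≤ k * ((n : ℝ) - 1)) ∧ ∑ i, p i ≤ k * ((n : ℝ) * ((n : ℝ) - 1) / 2) := by
  have hmono := Tuple.monotone_sort p
  set σ := Tuple.sort p
  have key : ∀ (r : ℕ) (hr : r < n), p (σ ⟨r, hr⟩) ≤ k * r := by
    intro r
    induction r with
    | zero =>
      intro hr
      obtain ⟨i, hi⟩ := hp
      have h1 : p (σ ⟨0, hr⟩) ≤ p (σ (σ.symm i)) := hmono (Nat.zero_le _ : (⟨0, hr⟩ : Fin n) ≤ _)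
      rw [Equiv.apply_symm_apply] at h1
      simpa using h1.trans hi
    | succ r ih =>
      intro hr
      have ih := ih (by omega)
      -- Prices may be negative here, whereas `hgap` requires a nonnegative threshold.
      set θ := max 0 (p (σ ⟨r, by omega⟩)) with hθ
      have hθk : θ ≤ k * r := max_le (by positivity) ih
      push_cast
      by_contra! hlt
      obtain ⟨i, hi, hi'⟩ := hgap θ (le_max_left _ _) ⟨σ ⟨r + 1, hr⟩, by linarith⟩
      have h1 : r < (σ.symm i : ℕ) := by
        by_contra! hle
        have : p (σ (σ.symm i)) ≤ p (σ ⟨r, by omega⟩) := hmono hle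
        rw [Equiv.apply_symm_apply] at this
        exact absurd (hi.trans_le this) (not_lt.2 (le_max_right _ _))
      have h2 : p (σ ⟨r + 1, hr⟩) ≤ p (σ (σ.symm i)) := hmono h1
      rw [Equiv.apply_symm_apply] at h2
      linarith
  refine ⟨fun i => ?_, ?_⟩
  · have h1 := key (σ.symm i) (σ.symm i).2
    have h2 : ((σ.symm i : ℕ) : ℝ) ≤ (n : ℝ) - 1 := by
      have : ((σ.symm i : ℕ) : ℝ) + 1 ≤ n := by exact_mod_cast (σ.symm i).2
      linarith
    simp only [Fin.eta, Equiv.apply_symm_apply] at h1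
    exact h1.trans (mul_le_mul_of_nonneg_left h2 hk)
  · rw [← Equiv.sum_comp σ, ← sum_fin_eq, Finset.mul_sum]
    exact Finset.sum_le_sum fun i _ => key i i.2

/-- If agents and columns are matched along the diagonal, with supporting prices from each of which
tight edges lead down to price zero, and there is a matching that is envy-free up to `k`, then
the prices are small. -/
theorem price_bounds {n : ℕ} (hn : 1 ≤ n) {w : Fin n → Fin n → ℝ} {p : Fin n → ℝ} {k : ℝ}
    (hk : 0 ≤ k) (hef : ∀ i j, w i j + p j ≤ w i i + p i)
    (htight : ∀ θ, 0 ≤ θ → (∃ i, θ < p i) →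
      ∃ i j, θ < p i ∧ p j ≤ θ ∧ w i j + p j = w i i + p i)
    (ρ : Equiv.Perm (Fin n)) (hρ : ∀ i j, w i j ≤ w i (ρ i) + k) :
    (∀ i, p i ≤ k * ((n : ℝ) - 1)) ∧ ∑ i, p i ≤ k * ((n : ℝ) * ((n : ℝ) - 1) / 2) := by
  classical
  refine bounds_of_gap_le ?_ hk fun θ hθ hex => ?_
  · by_contra! hpos
    obtain ⟨-, j, -, hj, -⟩ := htight 0 le_rfl ⟨⟨0, hn⟩, hpos _⟩
    exact absurd hj (not_le.2 (hpos j))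
  -- If no price lies in `(θ, θ + k]`, an agent whose `ρ`-column costs more than `θ` also has its
  -- own price above `θ`, because it prefers its own column to the `ρ`-column by at most `k`.
  -- Counting makes the two sets of agents equal, and a tight edge leaving this set yields envy
  -- above `k` under `ρ`.
  · by_contra! hgap
    have hsub : (Finset.univ.filter fun i => θ < p (ρ i)) ⊆ Finset.univ.filter fun i => θ < p i := by
      intro i hi
      simp only [Finset.mem_filter, Finset.mem_univ, true_and] at hi ⊢
      linarith [hgap _ hi, hef i (ρ i), hρ i i]
    have hcard : (Finset.univ.filter fun i => θ < p i).card ≤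
        (Finset.univ.filter fun i => θ < p (ρ i)).card := by
      refine Finset.card_le_card_of_injOn ρ.symm (fun i hi => ?_) ρ.symm.injective.injOn
      simpa using hi
    have heq := Finset.eq_of_subset_of_card_le hsub hcard
    obtain ⟨i, j, hi, hj, hij⟩ := htight θ hθ hex
    have hi' : i ∈ Finset.univ.filter fun i => θ < p (ρ i) := by
      rw [heq]; simpa using hi
    simp only [Finset.mem_filter, Finset.mem_univ, true_and] at hi'
    linarith [hgap _ hi', hef i (ρ i), hρ i j]

/-- Some matching of the agents to the bundles leaves no agent with envy of more than one. -/
def AlmostEnvyFree {n m : ℕ} (v : Valuations n m) (B : Fin n → Finset (Fin m)) : Prop :=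
  ∃ ρ : Equiv.Perm (Fin n), ∀ i j, v i (B j) ≤ v i (B (ρ i)) + 1

open Classical in
/-- Improve a matching so that along supporting prices no envy is left. -/
theorem exists_improved_matching {n : ℕ} {w : Fin n → Fin n → ℝ} {ρ : Equiv.Perm (Fin n)}
    (hρ : ∀ i j, w i j ≤ w i (ρ i) + 1) :
    ∃ (π : Equiv.Perm (Fin n)) (q : Fin n → ℝ), (∀ i j, w i j ≤ w i (π i) + 1) ∧
      ∀ i j, q (π i) ≤ q j → w i j ≤ w i (π i) := by
  -- The matching `ρ` has total weight zero and every weight is at most one, so the penalty `-n`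
  -- cannot be compensated by the other `n - 1` agents: an optimal matching makes nobody worse off.
  set u : Fin n → Fin n → ℝ := fun i j =>
    if w i (ρ i) ≤ w i j then w i j - w i (ρ i) else -n with hu
  obtain ⟨π, q, h⟩ := exists_supporting_prices u
  have hle : ∀ i j, u i j ≤ 1 := fun i j => by
    simp only [hu]
    split_ifs
    · linarith [hρ i j]
    · linarith [Nat.cast_nonneg (α := ℝ) n]
  have hsum : 0 ≤ ∑ i, u i (π i) := by
    have h1 : ∑ i, (u i (ρ i) + q (ρ i)) ≤ ∑ i, (u i (π i) + q (π i)) :=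
      Finset.sum_le_sum fun i _ => h i (ρ i)
    rw [Finset.sum_add_distrib, Finset.sum_add_distrib, Equiv.sum_comp ρ q, Equiv.sum_comp π q] at h1
    simpa [hu] using h1
  have himp : ∀ i, w i (ρ i) ≤ w i (π i) := by
    intro i
    by_contra hi
    have h1 : u i (π i) = -n := by simp [hu, hi]
    have h2 : ∑ j ∈ Finset.univ.erase i, u j (π j) ≤ ∑ j ∈ Finset.univ.erase i, (1 : ℝ) :=
      Finset.sum_le_sum fun j _ => hle _ _
    have h3 := Finset.add_sum_erase Finset.univ (fun j => u j (π j)) (Finset.mem_univ i)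
    have h4 : ((n - 1 : ℕ) : ℝ) < n := by
      exact_mod_cast Nat.sub_lt i.pos one_pos
    simp only [Finset.sum_const, Finset.card_erase_of_mem (Finset.mem_univ i), Finset.card_univ,
      Fintype.card_fin, nsmul_eq_mul, mul_one] at h2
    linarith
  refine ⟨π, q, fun i j => (hρ i j).trans (by linarith [himp i]), fun i j hij => ?_⟩
  have h1 := h i j
  simp only [hu, if_pos (himp i)] at h1
  split_ifs at h1 with h2
  · linarith
  · exact (not_le.1 h2).le.trans (himp i)

/-- An item can be added to one of the bundles. -/
theorem AlmostEnvyFree.exists_insert {n m : ℕ} {v : Valuations n m} {B : Fin n → Finset (Fin m)}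
    (hB : AlmostEnvyFree v B) (hn : 1 ≤ n) (hv : UnitMarginals v) (hd : DoublyMonotone v)
    {e : Fin m} (he : ∀ j, e ∉ B j) :
    ∃ j, AlmostEnvyFree v (Function.update B j (insert e (B j))) := by
  obtain ⟨ρ, hρ⟩ := hB
  obtain ⟨π, q, hπ, hq⟩ := exists_improved_matching (w := fun i j => v i (B j)) hρ
  have hmarg : ∀ i j, v i (insert e (B j)) ≤ v i (B j) + 1 ∧ v i (B j) ≤ v i (insert e (B j)) + 1 :=
    fun i j => by
      have := abs_le.1 (hv i e (B j) (he j))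
      constructor <;> linarith [this.1, this.2]
  by_cases hG : ∃ i, IsGood v i e
  -- The other agents for whom `e` is a good have no higher price and thus do not envy `i₀` yet; one
  -- item creates envy of at most one.
  · obtain ⟨i₀, hi₀, hmax⟩ := Set.exists_max_image {i | IsGood v i e} (fun i => q (π i))
      (Set.toFinite _) hG
    refine ⟨π i₀, π, fun i l => ?_⟩
    by_cases hi : i = i₀
    · subst hi
      rw [Function.update_self]
      by_cases hl : l = π i
      · subst hl; simp
      · rw [Function.update_of_ne hl]
        linarith [hπ i l, hi₀ (B (π i)) (he _)]
    · rw [Function.update_of_ne (by simpa using hi : π i ≠ π i₀)]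
      by_cases hl : l = π i₀
      · subst hl
        rw [Function.update_self]
        by_cases hg : IsGood v i e
        · linarith [hq i (π i₀) (hmax i hg), (hmarg i (π i₀)).1]
        · linarith [((hd i e).resolve_left hg).1 (B (π i₀)) (he _), hπ i (π i₀)]
      · rw [Function.update_of_ne hl]
        exact hπ i l
  · push Not at hG
    -- The agent with the lowest price envies nobody and can bear a loss of one.
    obtain ⟨i₀, -, hmin⟩ := Set.exists_min_image Set.univ (fun i => q (π i)) (Set.toFinite _)
      ⟨⟨0, hn⟩, trivial⟩
    refine ⟨π i₀, π, fun i l => ?_⟩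
    by_cases hi : i = i₀
    · subst hi
      rw [Function.update_self]
      by_cases hl : l = π i
      · subst hl; simp
      · rw [Function.update_of_ne hl]
        have := hmin (π.symm l) trivial
        rw [Equiv.apply_symm_apply] at this
        linarith [hq i l this, (hmarg i (π i)).2]
    · rw [Function.update_of_ne (by simpa using hi : π i ≠ π i₀)]
      by_cases hl : l = π i₀
      · subst hl
        rw [Function.update_self]
        linarith [((hd i e).resolve_left (hG i)).1 (B (π i₀)) (he _), hπ i (π i₀)]
      · rw [Function.update_of_ne hl]
        exact hπ i l

/-- An allocation that is envy-free up to `k` items leaves envy of at most `k`. -/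
theorem IsEFUpTo.envy_le {n m k : ℕ} {v : Valuations n m} {A : Fin n → Finset (Fin m)}
    (h : IsEFUpTo v k A) (hv : UnitMarginals v) (hA : IsAllocation A) (i j : Fin n) :
    v i (A j) ≤ v i (A i) + k := by
  -- Each removed item shifts a value by at most one; as the two bundles are disjoint, their shifts
  -- add up to at most `X.card`.
  have hsdiff : ∀ X Y : Finset (Fin m), |v i Y - v i (Y \ X)| ≤ (Y ∩ X).card := by
    intro X
    induction X using Finset.induction_on with
    | empty => intro Y; simp
    | insert e X he ih =>
      intro Y
      by_cases heY : e ∈ Y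
      · have h1 : Y ∩ insert e X = insert e (Y ∩ X) := Finset.inter_insert_of_mem heY
        have h2 : insert e (Y \ insert e X) = Y \ X := by
          ext a
          by_cases ha : a = e <;> simp [ha, heY, he]
        have h3 := hv i e (Y \ insert e X) (by simp)
        rw [h2] at h3
        rw [h1, Finset.card_insert_of_notMem (by simp [he])]
        push_cast
        have := abs_sub_le (v i Y) (v i (Y \ X)) (v i (Y \ insert e X))
        linarith [ih Y]
      · rw [Finset.inter_insert_of_notMem heY, Finset.sdiff_insert_of_notMem heY]
        exact ih Y
  rcases eq_or_ne i j with rfl | hij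
  · simp
  obtain ⟨X, hX, hk, hle⟩ := h i j
  have hdisj := hA.1 i j hij
  have h1 := abs_le.1 (hsdiff X (A i))
  have h2 := abs_le.1 (hsdiff X (A j))
  have hcard : (A i ∩ X).card + (A j ∩ X).card ≤ k := by
    rw [← Finset.card_union_of_disjoint (hdisj.mono Finset.inter_subset_left
      Finset.inter_subset_left), ← Finset.union_inter_distrib_right]
    exact (Finset.card_le_card Finset.inter_subset_right).trans hk
  have hcard' : ((A i ∩ X).card : ℝ) + (A j ∩ X).card ≤ k := by exact_mod_cast hcard
  linarith [h1.1, h2.2]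

end FairDivision

namespace FairDivision

/-! ## Subsidies for given bundles -/

/-- Query the values of all bundles (in array `1`) for all agents, and store them in the array `a`
of real numbers. -/
def fillValues (a : ℕ) : Program :=
  forLt 3 (.var 0) <| forLt 8 (.var 0) <| .query a (.var 3) (.var 8) (.var 3) 1 (.var 8)

/-- Find minimal nonnegative prices relative to the price of an additional column `n`, for which the
agents have the same weight as for the columns that they hold. -/
def minimizePrices : Program :=
  .seq (forLt 3 (.var 0) <| .setReal 1 (holderExpr (.var 3)) (.var 2)
    (.arr 1 (holderExpr (.var 3)) (.var 3))) growTree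

def writeOutput : Program :=
  forLt 3 (.var 0) <|
    .seq (.setReal 0 (.const 0) (holderExpr (.var 3))
      (.sub (.arr 2 (.const 0) (.var 3)) (.arr 2 (.const 0) (.var 0)))) <|
    forLt 8 (.var 1) <|
      .setArr 0 (holderExpr (.var 3)) (.var 8) (.arr 1 (.var 3) (.var 8))

/-- Assign the bundles in the array `1` to the agents and compute a subsidy. -/
def subsidize : Program :=
  .seq (fillValues 1) <| .seq matchColumns <| .seq minimizePrices writeOutput

variable {n m : ℕ} {v : Valuations n m} {s : Store}

theorem runs_fillValues (a : ℕ) (hn : s.var 0 = n) :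
    Runs v (fillValues a) s fun s' => ∀ i j : Fin n, s'.real a i j = v i (s.itemSet m 1 j) := by
  refine .forLt (N := n) (fun k s' => ∀ i j : Fin n, (i : ℕ) < k →
      s'.real a i j = v i (s.itemSet m 1 j))
    (by simp [forLt, Program.vars]) (fun s' hf => ?_) (by omega) (fun k s' l h => h) (by simp)
    (fun k hk s' hf hk' hI => ?_) (fun s' hf hs' hI i j => hI i j i.2)
  · simp [NatExpr.eval, hf.var 0 (by simp [forLt, Program.vars]), hn]
  refine .forLt (N := n) (fun l s'' => ∀ i j : Fin n, ((i : ℕ) < k ∨ (i : ℕ) = k ∧ (j : ℕ) < l) →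
      s''.real a i j = v i (s.itemSet m 1 j))
    (by simp [Program.vars]) (fun s'' hf' => ?_) (by omega) (fun k s' l h => h)
    (fun i j h => hI i j (by omega)) (fun l hl s'' hf' hl' hI' => ?_)
    (fun s'' hf' hs' hI' i j hi => hI' i j (by omega))
  · simp [NatExpr.eval, hf'.var 0 (by simp [forLt, Program.vars]),
      hf.var 0 (by simp [forLt, Program.vars]), hn]
  have v3 : s''.var 3 = k := (hf'.var 3 (by simp [forLt, Program.vars])).trans hk'
  refine .query (by simpa [NatExpr.eval, v3] using hk) fun i j hij => ?_
  simp only [NatExpr.eval, v3, hl', Store.setReal_real_self]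
  split_ifs with h
  · obtain ⟨rfl, rfl⟩ := h
    congr 1
    exact Store.itemSet_congr ((hf'.arr 1 (by simp [forLt, Program.arrs])).trans
      (hf.arr 1 (by simp [forLt, Program.arrs]))) _ _
  · exact hI' i j (by omega)

/-- Each agent values column `n` like its own, so its slack towards that column is a difference of
prices. Nonnegativity makes column `n` cheapest, and a parent edge to it forces equal prices. Hence
a chain of parents starting above `θ` must pass to a price of at most `θ` before it can reach the
root. -/
theorem runs_minimizePrices (hn : s.var 0 = n) (h2 : s.var 2 = n) (hH : s.HoldersBelow n)
    (hsl : ∀ c < n, ∀ j < n, 0 ≤ s.slack c j) :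
    Runs v minimizePrices s fun s' => (∀ i, ∀ j < n, s'.real 1 i j = s.real 1 i j) ∧
      (∀ c < n, s'.real 2 0 n ≤ s'.real 2 0 c) ∧
      (∀ c < n, ∀ j < n, 0 ≤ s'.slack c j) ∧
      ∀ θ, s'.real 2 0 n ≤ θ → (∃ c < n, θ < s'.real 2 0 c) →
        ∃ c < n, ∃ j < n, θ < s'.real 2 0 c ∧ s'.real 2 0 j ≤ θ ∧ s'.slack c j = 0 := by
  refine .seq (.conseq (.forLt (N := n) (fun k s' => (∀ i, ∀ j < n, s'.real 1 i j = s.real 1 i j) ∧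
      ∀ c < k, s'.real 1 (s.arr 2 0 c) n = s.real 1 (s.arr 2 0 c) c)
    (by decide) (fun s' hf => ?_) (by omega) (fun k s' l h => h) (by simp)
    (fun k hk s' hf hk' hI => .setReal ?_) (fun s' hf _ h => h)) ?_)
  · simp [NatExpr.eval, hf.var 0 (by decide), hn]
  · have a2 : s'.arr 2 = s.arr 2 := hf.arr 2 (by decide)
    have v2 : s'.var 2 = n := (hf.var 2 (by decide)).trans h2
    simp only [NatExpr.eval, RealExpr.eval, holderExpr, hk', a2, v2, Store.setReal_real_self]
    refine ⟨fun i j hj => ?_, fun c hc => ?_⟩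
    · rw [if_neg (by omega)]
      exact hI.1 i j hj
    · split_ifs with h
      · rw [hH.2 c (by omega) k hk h.1]
        exact hI.1 _ k hk
      · refine hI.2 c (lt_of_le_of_ne (by omega) ?_)
        rintro rfl
        simp at h
  · rintro s₁ hf₁ ⟨hW, hWn⟩
    have v2 : s₁.var 2 = n := (hf₁.var 2 (by decide)).trans h2
    have a2 : s₁.arr 2 = s.arr 2 := hf₁.arr 2 (by decide)
    have r2 : s₁.real 2 = s.real 2 := hf₁.real 2 (by decide)
    have hsl₁ : ∀ c < s₁.var 2, ∀ j < s₁.var 2, 0 ≤ s₁.slack c j := by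
      rw [v2]
      intro c hc j hj
      have := hsl c hc j hj
      simp only [Store.slack, Store.payoff] at this ⊢
      rwa [a2, r2, hW _ c hc, hW _ j hj]
    refine (runs_growTree (by omega) hsl₁).conseq ?_
    rintro s₂ hf₂ ⟨ord, hT⟩
    rw [v2] at hT
    have r1' : s₂.real 1 = s₁.real 1 := hf₂.real 1 (by decide)
    have a2' : s₂.arr 2 = s.arr 2 := (hf₂.arr 2 (by decide)).trans a2
    have hroot : ∀ c < n, s₂.slack c n = s₂.real 2 0 c - s₂.real 2 0 n := by
      intro c hc
      simp only [Store.slack, Store.payoff, r1', a2', hWn c hc, hW _ c hc]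
      ring
    refine ⟨fun i j hj => by rw [r1', hW i j hj], fun c hc => ?_,
      fun c hc j hj => hT.mem_nonneg c hc hc.le j hj.le, ?_⟩
    · have := hT.mem_nonneg c hc hc.le n le_rfl
      rw [hroot c hc] at this
      linarith
    · rintro θ hθ ⟨c₀, hc₀, hlt⟩
      have key : ∀ N c, c < n → ord c ≤ N → θ < s₂.real 2 0 c →
          ∃ c < n, ∃ j < n, θ < s₂.real 2 0 c ∧ s₂.real 2 0 j ≤ θ ∧ s₂.slack c j = 0 := by
        intro N
        induction N with
        | zero =>
          intro c hc ho
          have := hT.ord_par c hc hc.le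
          omega
        | succ N ih =>
          intro c hc ho hlt
          have h1 := hT.ord_par c hc hc.le
          have h2 := hT.tight c hc hc.le
          rcases (hT.par_le c hc hc.le).lt_or_eq with h3 | h3
          · rcases le_or_gt (s₂.real 2 0 (s₂.arr 4 0 c)) θ with h4 | h4
            · exact ⟨c, hc, _, h3, hlt, h4, h2⟩
            · exact ih _ h3 (by omega) h4
          · rw [h3, hroot c hc] at h2
            linarith
      exact key _ c₀ hc₀ le_rfl hlt

theorem runs_writeOutput (hn : s.var 0 = n) (hm : s.var 1 = m) (hH : s.HoldersBelow n) :
    Runs v writeOutput s fun s' => ∀ c < n,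
      s'.real 0 0 (s.arr 2 0 c) = s.real 2 0 c - s.real 2 0 n ∧
      ∀ e < m, s'.arr 0 (s.arr 2 0 c) e = s.arr 1 c e := by
  refine .forLt (N := n) (fun k s' => ∀ c < k,
      s'.real 0 0 (s.arr 2 0 c) = s.real 2 0 c - s.real 2 0 n ∧
      ∀ e < m, s'.arr 0 (s.arr 2 0 c) e = s.arr 1 c e)
    (by decide) (fun s' hf => ?_) (by omega) (fun k s' l h => h) (by simp)
    (fun k hk s' hf hk' hI => .seq (.setReal ?_)) (fun s' hf _ h => h)
  · simp [NatExpr.eval, hf.var 0 (by decide), hn]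
  have a1 : s'.arr 1 = s.arr 1 := hf.arr 1 (by decide)
  have a2 : s'.arr 2 = s.arr 2 := hf.arr 2 (by decide)
  have r2 : s'.real 2 = s.real 2 := hf.real 2 (by decide)
  have v0 : s'.var 0 = n := (hf.var 0 (by decide)).trans hn
  have v1 : s'.var 1 = m := (hf.var 1 (by decide)).trans hm
  simp only [NatExpr.eval, RealExpr.eval, holderExpr, hk', a2, r2, v0]
  have hne : ∀ c < k + 1, c ≠ k → s.arr 2 0 c ≠ s.arr 2 0 k := fun c hc hck e =>
    hck (hH.2 c (by omega) k hk e)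
  refine .forLt (N := m) (fun l s'' => (∀ c < k, ∀ e < m, s''.arr 0 (s.arr 2 0 c) e = s.arr 1 c e) ∧
      ∀ e < l, s''.arr 0 (s.arr 2 0 k) e = s.arr 1 k e)
    (by decide) (fun s'' hf' => ?_) (by omega) (fun k s' l h => h)
    ⟨fun c hc => (hI c hc).2, by simp⟩ (fun l hl s'' hf' hl' hI' => .setArr ?_)
    (fun s'' hf' hs' hI' c hc => ?_)
  · rw [NatExpr.eval, hf'.var 1 (by decide)]; exact v1
  · have a1' : s''.arr 1 = s.arr 1 := (hf'.arr 1 (by decide)).trans a1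
    have a2' : s''.arr 2 = s.arr 2 := (hf'.arr 2 (by decide)).trans a2
    have v3' : s''.var 3 = k := (hf'.var 3 (by decide)).trans hk'
    simp only [NatExpr.eval, hl', v3', a1', a2', Store.setArr_arr_self]
    refine ⟨fun c hc e he => ?_, fun e he => ?_⟩
    · rw [if_neg fun h => hne c (by omega) (by omega) h.1]
      exact hI'.1 c hc e he
    · split_ifs with h
      · rw [h.2]
      · exact hI'.2 e (by grind)
  · have r0 : s''.real 0 = _ := hf'.real 0 (by decide)
    rw [r0, Store.setReal_real_self]
    rcases Nat.lt_succ_iff_lt_or_eq.1 hc with hc' | rfl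
    · rw [if_neg fun h => hne c hc (by omega) h.2]
      exact ⟨(hI c hc').1, hI'.1 c hc'⟩
    · exact ⟨if_pos ⟨rfl, rfl⟩, hI'.2⟩

/-- The program `subsidize` outputs a reassignment of the bundles and supporting prices from each
of which tight edges lead down to price zero. -/
theorem runs_subsidize (hn : s.var 0 = n) (hm : s.var 1 = m) :
    Runs v subsidize s fun s' => ∃ σ : Equiv.Perm (Fin n),
      (∀ i, s'.outputAllocation n m i = s.itemSet m 1 (σ i)) ∧
      (∀ i, 0 ≤ s'.outputSubsidy n i) ∧
      (∀ i j, v i (s.itemSet m 1 (σ j)) + s'.outputSubsidy n j ≤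
        v i (s.itemSet m 1 (σ i)) + s'.outputSubsidy n i) ∧
      ∀ θ, 0 ≤ θ → (∃ i, θ < s'.outputSubsidy n i) → ∃ i j, θ < s'.outputSubsidy n i ∧
        s'.outputSubsidy n j ≤ θ ∧ v i (s.itemSet m 1 (σ j)) + s'.outputSubsidy n j =
          v i (s.itemSet m 1 (σ i)) + s'.outputSubsidy n i := by
  refine .seq ((runs_fillValues 1 hn).conseq fun s₁ hf₁ hW => ?_)
  have hn₁ : s₁.var 0 = n := (hf₁.var 0 (by decide)).trans hn
  refine .seq ((runs_matchColumns hn₁).conseq ?_)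
  rintro s₂ hf₂ ⟨h2₂, hH₂, hsl₂⟩
  have hn₂ : s₂.var 0 = n := (hf₂.var 0 (by decide)).trans hn₁
  refine .seq ((runs_minimizePrices hn₂ h2₂ hH₂ hsl₂).conseq ?_)
  rintro s₃ hf₃ ⟨hW₃, hroot, hsl₃, htight⟩
  have a2₃ : s₃.arr 2 = s₂.arr 2 := hf₃.arr 2 (by decide)
  have hn₃ : s₃.var 0 = n := (hf₃.var 0 (by decide)).trans hn₂
  have hm₃ : s₃.var 1 = m := (hf₃.var 1 (by decide)).trans ((hf₂.var 1 (by decide)).trans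
    ((hf₁.var 1 (by decide)).trans hm))
  have hH₃ : s₃.HoldersBelow n := by
    rw [Store.HoldersBelow, a2₃]; exact hH₂
  obtain ⟨τ, hτ⟩ := hH₃.exists_perm
  refine (runs_writeOutput hn₃ hm₃ hH₃).conseq fun s₄ hf₄ hout => ?_
  have a1₃ : s₃.arr 1 = s.arr 1 := (hf₃.arr 1 (by decide)).trans ((hf₂.arr 1 (by decide)).trans
    (hf₁.arr 1 (by decide)))
  have hW₃' : ∀ i j : Fin n, s₃.real 1 i j = v i (s.itemSet m 1 j) := fun i j => by
    rw [hW₃ i j j.2, hf₂.real 1 (by decide), hW]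
  have hp : ∀ c, s₄.outputSubsidy n (τ c) = s₃.real 2 0 c - s₃.real 2 0 n := fun c => by
    rw [← (hout c c.2).1, hτ]; rfl
  have hsl : ∀ c j : Fin n, s₃.slack c j = v (τ c) (s.itemSet m 1 c) + s₃.real 2 0 c -
      (v (τ c) (s.itemSet m 1 j) + s₃.real 2 0 j) := fun c j => by
    rw [Store.slack, Store.payoff, Store.payoff, hτ, hW₃', hW₃']
  refine ⟨τ.symm, τ.forall_congr_right.1 fun c => ?_, τ.forall_congr_right.1 fun c => ?_,
    τ.forall_congr_right.1 fun c => τ.forall_congr_right.1 fun j => ?_, ?_⟩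
  · rw [Equiv.symm_apply_apply]
    ext e
    rw [Store.outputAllocation, Store.mem_itemSet, Store.mem_itemSet, ← hτ, (hout c c.2).2 e e.2, a1₃]
  · rw [hp]
    linarith [hroot c c.2]
  · rw [hp, hp, Equiv.symm_apply_apply, Equiv.symm_apply_apply]
    have := hsl₃ c c.2 j j.2
    rw [hsl] at this
    linarith
  · rintro θ hθ ⟨i, hi⟩
    obtain ⟨i, rfl⟩ := τ.surjective i
    rw [hp] at hi
    obtain ⟨c, hc, j, hj, h1, h2, h3⟩ := htight (θ + s₃.real 2 0 n) (by linarith)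
      ⟨i, i.2, by linarith⟩
    refine ⟨τ ⟨c, hc⟩, τ ⟨j, hj⟩, ?_, ?_, ?_⟩
    · rw [hp]; simp only; linarith
    · rw [hp]; simp only; linarith
    · have := hsl ⟨c, hc⟩ ⟨j, hj⟩
      simp only [h3] at this
      rw [hp, hp, Equiv.symm_apply_apply, Equiv.symm_apply_apply]
      simp only
      linarith

/-- If the bundles can be assigned with envy at most `k`, then `subsidize` outputs a solution. -/
theorem runs_subsidize_of_envy_le {k : ℕ} (h1 : 1 ≤ n) (hn : s.var 0 = n) (hm : s.var 1 = m)
    (hA : IsAllocation fun j : Fin n => s.itemSet m 1 j) (ρ : Equiv.Perm (Fin n))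
    (hρ : ∀ i j : Fin n, v i (s.itemSet m 1 j) ≤ v i (s.itemSet m 1 (ρ i)) + k) :
    Runs v subsidize s fun s' => ∃ σ : Equiv.Perm (Fin n),
      (∀ i, s'.outputAllocation n m i = s.itemSet m 1 (σ i)) ∧
      IsEnvyFreeWithSubsidy v (s'.outputAllocation n m) (s'.outputSubsidy n) ∧
      (∀ i, s'.outputSubsidy n i ≤ (k : ℝ) * ((n : ℝ) - 1)) ∧
      ∑ i, s'.outputSubsidy n i ≤ (k : ℝ) * ((n : ℝ) * ((n : ℝ) - 1) / 2) := by
  refine (runs_subsidize hn hm).conseq ?_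
  rintro s' - ⟨σ, hσ, hp, hef, htight⟩
  refine ⟨σ, hσ, ⟨⟨fun i j hij => ?_, fun e => ?_⟩, hp, fun i j => ?_⟩, ?_⟩
  · rw [hσ, hσ]
    exact hA.1 _ _ (σ.injective.ne hij)
  · obtain ⟨j, hj⟩ := hA.2 e
    exact ⟨σ.symm j, by rwa [hσ, Equiv.apply_symm_apply]⟩
  · rw [hσ, hσ]
    exact hef i j
  -- Bundles are reindexed by their new owners, which turns the reference matching `ρ` into `ρ`
  -- followed by the inverse of `σ`.
  · exact price_bounds h1 k.cast_nonneg hef htight (ρ.trans σ.symm) fun i j => by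
      simpa using hρ i (σ j)

end FairDivision

namespace FairDivision

/-! ## Finding bundles that almost avoid envy -/

/-- Set the weight of a column to one or zero, according as an agent values it almost the most. -/
def indicateTop : Program :=
  .seq (.setReal 1 (.var 3) (.var 8) .one) <|
    forLt 4 (.var 0) <|
      .ite (.realLe (.arr 3 (.var 3) (.var 4)) (.add (.arr 3 (.var 3) (.var 8)) .one)) .skip
        (.setReal 1 (.var 3) (.var 8) .zero)

def fillIndicators : Program := forLt 3 (.var 0) <| forLt 8 (.var 0) indicateTop

/-- Test whether all agents hold columns of weight one. -/
def checkHolders : Program :=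
  .seq (.setVar 12 (.const 1)) <|
    forLt 3 (.var 0) <|
      .ite (.realLe .one (.arr 1 (holderExpr (.var 3)) (.var 3))) .skip (.setVar 12 (.const 0))

/-- Set the variable `12` to one if and only if the bundles in the array `1` can be assigned with
envy at most one. -/
def testBundles : Program :=
  .seq (fillValues 3) <| .seq fillIndicators <| .seq matchColumns checkHolders

variable {n m : ℕ} {v : Valuations n m} {s : Store}

theorem runs_indicateTop (hn : s.var 0 = n) :
    Runs v indicateTop s fun s' =>
      (((∀ l < n, s.real 3 (s.var 3) l ≤ s.real 3 (s.var 3) (s.var 8) + 1) ∧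
          s'.real 1 (s.var 3) (s.var 8) = 1) ∨
        ((¬ ∀ l < n, s.real 3 (s.var 3) l ≤ s.real 3 (s.var 3) (s.var 8) + 1) ∧
          s'.real 1 (s.var 3) (s.var 8) = 0)) ∧
      ∀ i j, ¬ (i = s.var 3 ∧ j = s.var 8) → s'.real 1 i j = s.real 1 i j := by
  refine .seq (.setReal (.forLt (N := n) (fun k s' =>
      (((∀ l < k, s.real 3 (s.var 3) l ≤ s.real 3 (s.var 3) (s.var 8) + 1) ∧
          s'.real 1 (s.var 3) (s.var 8) = 1) ∨
        ((¬ ∀ l < k, s.real 3 (s.var 3) l ≤ s.real 3 (s.var 3) (s.var 8) + 1) ∧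
          s'.real 1 (s.var 3) (s.var 8) = 0)) ∧
      ∀ i j, ¬ (i = s.var 3 ∧ j = s.var 8) → s'.real 1 i j = s.real 1 i j)
    (by decide) (fun s' hf => ?_) (by omega) (fun k s' l h => h) ?_
    (fun k hk s' hf hk' hI => ?_) (fun s' hf _ h => h)))
  · simp [NatExpr.eval, hf.var 0 (by decide), hn]
  · refine ⟨.inl ⟨by simp, by simp [NatExpr.eval, RealExpr.eval]⟩, fun i j hij => ?_⟩
    simp [NatExpr.eval, hij]
  have v3 : s'.var 3 = s.var 3 := hf.var 3 (by decide)
  have v8 : s'.var 8 = s.var 8 := hf.var 8 (by decide)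
  have r3 : s'.real 3 = s.real 3 := hf.real 3 (by decide)
  refine .ite (fun h => .skip ?_) (fun h => .setReal ?_)
  · simp only [Cond.Holds, RealExpr.eval, NatExpr.eval, v3, v8, r3, hk'] at h
    refine ⟨hI.1.imp (.imp_left fun h' l hl => ?_) (.imp_left fun h' h'' => ?_), hI.2⟩
    · rcases Nat.lt_succ_iff_lt_or_eq.1 hl with hl | rfl
      exacts [h' l hl, h]
    · exact h' fun l hl => h'' l (by omega)
  · simp only [Cond.Holds, RealExpr.eval, NatExpr.eval, v3, v8, r3, hk'] at h
    refine ⟨.inr ⟨fun h' => h (h' k (by omega)), ?_⟩, fun i j hij => ?_⟩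
    · simp [NatExpr.eval, RealExpr.eval, v3, v8]
    · simpa [NatExpr.eval, v3, v8, hij] using hI.2 i j hij

/-- The entry of the array `1` of real numbers indicates whether an agent values a column almost
the most, according to the array `3`. -/
def Store.Indicates (s s' : Store) (n i j : ℕ) : Prop :=
  ((∀ l < n, s.real 3 i l ≤ s.real 3 i j + 1) ∧ s'.real 1 i j = 1) ∨
    ((¬ ∀ l < n, s.real 3 i l ≤ s.real 3 i j + 1) ∧ s'.real 1 i j = 0)

theorem runs_fillIndicators (hn : s.var 0 = n) :
    Runs v fillIndicators s fun s' => ∀ i < n, ∀ j < n, s.Indicates s' n i j := by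
  refine .forLt (N := n) (fun k s' => ∀ i < k, ∀ j < n, s.Indicates s' n i j)
    (by decide) (fun s' hf => ?_) (by omega) (fun k s' l h => h) (by simp)
    (fun k hk s' hf hk' hI => ?_) (fun s' hf hs' hI => hI)
  · simp [NatExpr.eval, hf.var 0 (by decide), hn]
  refine .forLt (N := n) (fun l s'' => ∀ i j, j < n → (i < k ∨ i = k ∧ j < l) →
      s.Indicates s'' n i j)
    (by decide) (fun s'' hf' => ?_) (by omega) (fun k s' l h => h)
    (fun i j hj h => hI i (by omega) j hj) (fun l hl s'' hf' hl' hI' => ?_)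
    (fun s'' hf' hs' hI' i hi j hj => hI' i j hj (by omega))
  · simp [NatExpr.eval, hf'.var 0 (by decide), hf.var 0 (by decide), hn]
  have v3 : s''.var 3 = k := (hf'.var 3 (by decide)).trans hk'
  have r3 : s''.real 3 = s.real 3 := (hf'.real 3 (by decide)).trans (hf.real 3 (by decide))
  have v0 : s''.var 0 = n := (hf'.var 0 (by decide)).trans ((hf.var 0 (by decide)).trans hn)
  refine (runs_indicateTop v0).conseq fun s₃ _ h => ?_
  rw [v3, hl', r3] at h
  intro i j hj hij
  by_cases e : i = k ∧ j = l
  · rw [e.1, e.2]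
    exact h.1
  · rw [Store.Indicates, h.2 i j e]
    exact hI' i j hj (by omega)

theorem runs_checkHolders (hn : s.var 0 = n) :
    Runs v checkHolders s fun s' =>
      s'.var 12 = 1 ↔ ∀ c < n, 1 ≤ s.real 1 (s.arr 2 0 c) c := by
  refine .seq (.setVar (.forLt (N := n) (fun k s' =>
      s'.var 12 = 1 ↔ ∀ c < k, 1 ≤ s.real 1 (s.arr 2 0 c) c)
    (by decide) (fun s' hf => ?_) (by omega) (fun k s' l h => h) (by simp [NatExpr.eval])
    (fun k hk s' hf hk' hI => ?_) (fun s' hf hs' hI => hI)))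
  · simp [NatExpr.eval, hf.var 0 (by decide), hn]
  have a2 : s'.arr 2 = s.arr 2 := hf.arr 2 (by decide)
  have r1 : s'.real 1 = s.real 1 := hf.real 1 (by decide)
  refine .ite (fun h => .skip ?_) (fun h => .setVar ?_)
  · simp only [Cond.Holds, RealExpr.eval, NatExpr.eval, holderExpr, a2, r1, hk'] at h
    rw [hI]
    refine ⟨fun h' c hc => ?_, fun h' c hc => h' c (by omega)⟩
    rcases Nat.lt_succ_iff_lt_or_eq.1 hc with hc | rfl
    exacts [h' c hc, h]
  · simp only [Cond.Holds, RealExpr.eval, NatExpr.eval, holderExpr, a2, r1, hk'] at h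
    simp only [NatExpr.eval, Store.setVar_var, if_true]
    exact ⟨fun h' => absurd h' (by decide), fun h' => absurd (h' k (by omega)) h⟩

/-- The weights are zero or one, so a suitable assignment exists exactly when a maximum weight
matching uses only edges of weight one. Optimality follows by summing the slack inequalities, in
which the prices cancel. -/
theorem runs_testBundles (hn : s.var 0 = n) :
    Runs v testBundles s fun s' =>
      s'.var 12 = 1 ↔ AlmostEnvyFree v fun j => s.itemSet m 1 j := by
  refine .seq ((runs_fillValues 3 hn).conseq fun s₁ hf₁ hV => ?_)
  have hn₁ : s₁.var 0 = n := (hf₁.var 0 (by decide)).trans hn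
  refine .seq ((runs_fillIndicators hn₁).conseq fun s₂ hf₂ hW => ?_)
  have hn₂ : s₂.var 0 = n := (hf₂.var 0 (by decide)).trans hn₁
  refine .seq ((runs_matchColumns hn₂).conseq ?_)
  rintro s₃ hf₃ ⟨-, hH, hsl⟩
  have hn₃ : s₃.var 0 = n := (hf₃.var 0 (by decide)).trans hn₂
  refine (runs_checkHolders hn₃).conseq fun s₄ _ h => ?_
  rw [h]
  obtain ⟨σ, hσ⟩ := hH.exists_perm
  have r1 : s₃.real 1 = s₂.real 1 := hf₃.real 1 (by decide)
  have hind : ∀ i j : Fin n,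
      ((∀ l : Fin n, v i (s.itemSet m 1 l) ≤ v i (s.itemSet m 1 j) + 1) ∧ s₃.real 1 i j = 1) ∨
      ((¬ ∀ l : Fin n, v i (s.itemSet m 1 l) ≤ v i (s.itemSet m 1 j) + 1) ∧ s₃.real 1 i j = 0) := by
    intro i j
    have h1 := hW i i.2 j j.2
    have h2 : (∀ l < n, s₁.real 3 i l ≤ s₁.real 3 i j + 1) ↔
        ∀ l : Fin n, v i (s.itemSet m 1 l) ≤ v i (s.itemSet m 1 j) + 1 := by
      simp only [← hV]
      exact ⟨fun h l => h l l.2, fun h l hl => h ⟨l, hl⟩⟩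
    rwa [Store.Indicates, h2, ← r1] at h1
  constructor
  · intro h
    refine ⟨σ.symm, σ.forall_congr_right.1 fun c j => ?_⟩
    rw [Equiv.symm_apply_apply]
    have h1 := h c c.2
    rw [hσ] at h1
    rcases hind (σ c) c with h2 | h2
    · exact h2.1 j
    · linarith [h2.2]
  · rintro ⟨ρ, hρ⟩
    have hle : ∀ i j : Fin n, s₃.real 1 i j ≤ 1 := fun i j => by
      rcases hind i j with h | h <;> linarith [h.2]
    have hone : ∀ i : Fin n, s₃.real 1 i (ρ i) = 1 := fun i =>
      ((hind i (ρ i)).resolve_right fun h => h.1 fun l => hρ i l).2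
    have hsl' : ∀ c : Fin n, 1 + s₃.real 2 0 (ρ (σ c)) ≤ s₃.real 1 (σ c) c + s₃.real 2 0 c := by
      intro c
      have := hsl c c.2 _ (ρ (σ c)).2
      rw [Store.slack, Store.payoff, Store.payoff, hσ, hone] at this
      linarith
    have hsum : ∑ c : Fin n, (1 : ℝ) ≤ ∑ c : Fin n, s₃.real 1 (σ c) c := by
      have h1 := Finset.sum_le_sum fun c (_ : c ∈ Finset.univ) => hsl' c
      have h2 := Equiv.sum_comp (σ.trans ρ) fun c : Fin n => s₃.real 2 0 c
      simp only [Equiv.trans_apply] at h2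
      rw [Finset.sum_add_distrib, Finset.sum_add_distrib, h2] at h1
      linarith
    have heq := (Finset.sum_eq_sum_iff_of_le fun c (_ : c ∈ Finset.univ) => hle (σ c) c).1
      (le_antisymm (Finset.sum_le_sum fun c _ => hle (σ c) c) hsum)
    intro c hc
    rw [show s₃.arr 2 0 c = σ ⟨c, hc⟩ from hσ ⟨c, hc⟩]
    exact (heq ⟨c, hc⟩ (Finset.mem_univ _)).ge

/-- Add the item `e`, the value of the variable `9`, to a bundle. -/
def placeItem : Program :=
  .seq (.setVar 10 (.const 0)) <|
    forLt 11 (.var 0) <|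
      .ite (.natEq (.var 10) (.const 0))
        (.seq (.setArr 1 (.var 11) (.var 9) (.const 1)) <|
          .seq testBundles <|
            .ite (.natEq (.var 12) (.const 1)) (.setVar 10 (.const 1))
              (.setArr 1 (.var 11) (.var 9) (.const 0)))
        .skip

def placeItems : Program := forLt 9 (.var 1) placeItem

theorem itemSet_setArr {k : ℕ} (hk : k < m) (j : Fin n) :
    (fun i : Fin n => (s.setArr 1 j k 1).itemSet m 1 i) =
      Function.update (fun i : Fin n => s.itemSet m 1 i) j (insert ⟨k, hk⟩ (s.itemSet m 1 j)) := by
  ext i e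
  rw [Store.mem_itemSet, Store.setArr_arr_self, Function.update_apply]
  by_cases hi : i = j
  · subst hi
    by_cases he : (e : ℕ) = k
    · simp [Fin.ext_iff, he]
    · simp [Fin.ext_iff, he]
  · simp [hi, Fin.val_inj]

/-- The program tries all bundles and never determines for whom the item is a good;
`AlmostEnvyFree.exists_insert` is only needed to rule out that all trials fail. -/
theorem runs_placeItem (h1 : 1 ≤ n) (hn : s.var 0 = n) (h9 : s.var 9 < m) (hv : UnitMarginals v)
    (hd : DoublyMonotone v) (hs : AlmostEnvyFree v fun j => s.itemSet m 1 j)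
    (h0 : ∀ j < n, s.arr 1 j (s.var 9) = 0) :
    Runs v placeItem s fun s' => (AlmostEnvyFree v fun j => s'.itemSet m 1 j) ∧
      ∃ j < n, s'.arr 1 = (s.setArr 1 j (s.var 9) 1).arr 1 := by
  refine .seq (.setVar (.forLt (N := n) (fun k s' => (s'.var 10 = 0 ∧ s'.arr 1 = s.arr 1 ∧
      ∀ j : Fin n, (j : ℕ) < k →
        ¬ AlmostEnvyFree v fun i => (s.setArr 1 j (s.var 9) 1).itemSet m 1 i) ∨
      (s'.var 10 = 1 ∧ (AlmostEnvyFree v fun j => s'.itemSet m 1 j) ∧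
        ∃ j < n, s'.arr 1 = (s.setArr 1 j (s.var 9) 1).arr 1))
    (by decide) (fun s' hf => ?_) (by omega) (fun k s' l h => h) (.inl ⟨rfl, rfl, by simp⟩)
    (fun k hk s' hf hk' hI => ?_) (fun s' hf hs' hI => ?_)))
  · simp [NatExpr.eval, hf.var 0 (by decide), hn]
  · have v9 : s'.var 9 = s.var 9 := hf.var 9 (by decide)
    have v0 : s'.var 0 = n := (hf.var 0 (by decide)).trans hn
    refine .ite (fun h => ?_) (fun h => .skip (.inr (hI.resolve_left fun h' => h h'.1)))
    obtain ⟨h10, ha, hno⟩ := hI.resolve_right fun h' => by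
      have : s'.var 10 = 0 := h
      omega
    refine .seq (.setArr ?_)
    simp only [NatExpr.eval, hk', v9]
    refine .seq ((runs_testBundles (s := s'.setArr 1 k (s.var 9) 1) v0).conseq fun s'' hf'' hT => ?_)
    have a1 : s''.arr 1 = (s.setArr 1 k (s.var 9) 1).arr 1 := by
      rw [hf''.arr 1 (by decide)]
      ext i e
      simp [ha]
    have hset : (fun j : Fin n => (s'.setArr 1 k (s.var 9) 1).itemSet m 1 j) =
        fun j : Fin n => (s.setArr 1 k (s.var 9) 1).itemSet m 1 j := by
      funext j
      exact Store.itemSet_congr (by ext i e; simp [ha]) _ _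
    rw [hset] at hT
    refine .ite (fun h => .setVar (.inr ⟨rfl, ?_, k, hk, a1⟩)) (fun h => .setArr (.inl ⟨?_, ?_, ?_⟩))
    · convert hT.1 h using 1
      funext j
      exact Store.itemSet_congr a1 _ _
    · exact (hf''.var 10 (by decide)).trans h10
    · have v11 : s''.var 11 = k := (hf''.var 11 (by decide)).trans hk'
      have v9' : s''.var 9 = s.var 9 := (hf''.var 9 (by decide)).trans v9
      ext i e
      simp only [NatExpr.eval, v11, v9', Store.setArr_arr_self, a1]
      split_ifs with hie
      · rw [hie.1, hie.2, h0 k hk]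
      · rfl
    · intro j hj
      rcases Nat.lt_succ_iff_lt_or_eq.1 hj with hj | hj
      · exact hno j hj
      · rw [hj]
        exact fun h' => h (hT.2 h')
  · refine (hI.resolve_left fun h => ?_).2
    obtain ⟨j, hj⟩ := hs.exists_insert h1 hv hd (e := ⟨s.var 9, h9⟩) fun j => by
      simp [h0 j j.2]
    refine h.2.2 j j.2 ?_
    rwa [itemSet_setArr h9]

theorem runs_placeItems (h1 : 1 ≤ n) (hn : s.var 0 = n) (hm : s.var 1 = m) (hv : UnitMarginals v)
    (hd : DoublyMonotone v) (h0 : ∀ j e, s.arr 1 j e = 0) :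
    Runs v placeItems s fun s' => (AlmostEnvyFree v fun j => s'.itemSet m 1 j) ∧
      IsAllocation fun j : Fin n => s'.itemSet m 1 j := by
  refine .forLt (N := m) (fun k s' => (AlmostEnvyFree v fun j => s'.itemSet m 1 j) ∧
      (∀ j, ∀ e ≥ k, s'.arr 1 j e = 0) ∧ (∀ e < k, ∃ j < n, s'.arr 1 j e ≠ 0) ∧
      ∀ i j e, s'.arr 1 i e ≠ 0 → s'.arr 1 j e ≠ 0 → i = j)
    (by decide) (fun s' hf => ?_) (by omega) (fun k s' l h => h) ?_
    (fun k hk s' hf hk' hI => ?_) (fun s' hf hs' hI => ⟨hI.1, fun i j hij => ?_, fun e => ?_⟩)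
  · simp [NatExpr.eval, hf.var 1 (by decide), hm]
  · refine ⟨⟨1, fun i j => ?_⟩, fun j e _ => h0 j e, by simp, fun i j e h => absurd (h0 i e) h⟩
    simp [Store.itemSet, h0]
  · obtain ⟨hA, hz, hex, huniq⟩ := hI
    have v0 : s'.var 0 = n := (hf.var 0 (by decide)).trans hn
    refine (runs_placeItem h1 v0 (hk'.trans_lt hk) hv hd hA fun j _ => hz j _ hk'.ge).conseq ?_
    rintro s'' - ⟨hA', j₀, hj₀, ha⟩
    have ha' : ∀ j e, s''.arr 1 j e = if j = j₀ ∧ e = k then 1 else s'.arr 1 j e := by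
      intro j e
      rw [ha, Store.setArr_arr_self, hk']
    refine ⟨hA', fun j e he => ?_, fun e he => ?_, fun i j e => ?_⟩
    · rw [ha', if_neg (by omega), hz j e (by omega)]
    · rcases Nat.lt_succ_iff_lt_or_eq.1 he with he | rfl
      · obtain ⟨j, hj, hje⟩ := hex e he
        exact ⟨j, hj, by rw [ha', if_neg (by omega)]; exact hje⟩
      · exact ⟨j₀, hj₀, by simp [ha']⟩
    · rw [ha', ha']
      have hi := hz i k le_rfl
      have hj := hz j k le_rfl
      have := huniq i j e
      split_ifs <;> grind
  · rw [Finset.disjoint_left]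
    intro e hi hj
    exact hij (Fin.ext (hI.2.2.2 i j e (by simpa using hi) (by simpa using hj)))
  · obtain ⟨j, hj, h⟩ := hI.2.2.1 e e.2
    exact ⟨⟨j, hj⟩, by simpa using h⟩

end FairDivision

/-! ### Cut and choose for two agents -/

namespace FairDivision

/-- For two agents: move items from the second bundle to the first one
until the first agent is almost indifferent. -/
def splitItems : Program :=
  .seq (forLt 8 (.var 1) <| .setArr 1 (.const 1) (.var 8) (.const 1)) <|
    forLt 9 (.var 1) <|
      .seq (.query 3 (.const 0) (.const 0) (.const 0) 1 (.const 0)) <|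
      .seq (.query 3 (.const 0) (.const 1) (.const 0) 1 (.const 1)) <|
      .ite (.and
          (.realLe (.arr 3 (.const 0) (.const 0)) (.add (.arr 3 (.const 0) (.const 1)) .one))
          (.realLe (.arr 3 (.const 0) (.const 1)) (.add (.arr 3 (.const 0) (.const 0)) .one)))
        .skip <|
        .seq (.setArr 1 (.const 1) (.var 9) (.const 0)) (.setArr 1 (.const 0) (.var 9) (.const 1))

variable {n m : ℕ} {s : Store}

/-- The first `l` items are worth almost the same as the remaining ones. -/
def Balanced {m : ℕ} (f : Finset (Fin m) → ℝ) (l : ℕ) : Prop :=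
  |f (Finset.univ.filter fun e => (e : ℕ) < l) - f (Finset.univ.filter fun e => l ≤ (e : ℕ))| ≤ 1

/-- Moving one item changes the difference of the two values by at most two, so it cannot jump
across `[-1, 1]`; but its values at the two extreme cuts are opposite. -/
theorem exists_balanced (f : Finset (Fin m) → ℝ) (hf : ∀ e X, e ∉ X → |f (insert e X) - f X| ≤ 1) :
    ∃ l ≤ m, Balanced f l := by
  by_contra! h
  simp only [Balanced, not_le] at h
  set P : ℕ → Finset (Fin m) := fun l => Finset.univ.filter fun e => (e : ℕ) < l with hP
  set R : ℕ → Finset (Fin m) := fun l => Finset.univ.filter fun e => l ≤ (e : ℕ) with hR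
  have hP0 : P 0 = ∅ := by simp [hP]
  have hRm : R m = ∅ := by simp [hR]
  have hPm : P m = Finset.univ := by simp [hP]
  have hR0 : R 0 = Finset.univ := by simp [hR]
  have hstep : ∀ l < m, |(f (P (l + 1)) - f (R (l + 1))) - (f (P l) - f (R l))| ≤ 2 := by
    intro l hl
    have h1 : P (l + 1) = insert ⟨l, hl⟩ (P l) := by
      ext e; simp [hP, Fin.ext_iff]; omega
    have h2 : R l = insert ⟨l, hl⟩ (R (l + 1)) := by
      ext e; simp [hR, Fin.ext_iff]; omega
    have h3 := hf ⟨l, hl⟩ (P l) (by simp [hP])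
    have h4 := hf ⟨l, hl⟩ (R (l + 1)) (by simp [hR])
    rw [← h1] at h3
    rw [← h2] at h4
    rw [abs_le] at h3 h4 ⊢
    constructor <;> linarith [h3.1, h3.2, h4.1, h4.2]
  have hends : f (P m) - f (R m) = -(f (P 0) - f (R 0)) := by
    rw [hP0, hRm, hPm, hR0]; ring
  rcases lt_abs.1 (h 0 (Nat.zero_le _)) with h0 | h0
  · have : ∀ l ≤ m, 1 < f (P l) - f (R l) := by
      intro l
      induction l with
      | zero => exact fun _ => h0
      | succ l ih =>
        intro hl
        have h1 := ih (by omega)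
        have h2 := abs_le.1 (hstep l hl)
        rcases lt_abs.1 (h (l + 1) hl) with h3 | h3
        · exact h3
        · linarith [h2.1]
    linarith [this m le_rfl, this 0 (Nat.zero_le _)]
  · have : ∀ l ≤ m, 1 < -(f (P l) - f (R l)) := by
      intro l
      induction l with
      | zero => exact fun _ => h0
      | succ l ih =>
        intro hl
        have h1 := ih (by omega)
        have h2 := abs_le.1 (hstep l hl)
        rcases lt_abs.1 (h (l + 1) hl) with h3 | h3
        · linarith [h2.2]
        · exact h3
    linarith [this m le_rfl, this 0 (Nat.zero_le _)]

/-- The first bundle consists of the first `l` items, the second one of the others. -/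
def Store.SplitAt (s : Store) (m l : ℕ) : Prop :=
  ∀ e < m, s.arr 1 0 e = (if e < l then 1 else 0) ∧ s.arr 1 1 e = if e < l then 0 else 1

theorem Store.SplitAt.itemSet_zero {l : ℕ} (h : s.SplitAt m l) :
    s.itemSet m 1 0 = Finset.univ.filter fun e : Fin m => (e : ℕ) < l := by
  ext e
  simp [(h e e.2).1]

theorem Store.SplitAt.itemSet_one {l : ℕ} (h : s.SplitAt m l) :
    s.itemSet m 1 1 = Finset.univ.filter fun e : Fin m => l ≤ (e : ℕ) := by
  ext e
  simp [(h e e.2).2]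

theorem Store.SplitAt.balanced_iff {l : ℕ} (h : s.SplitAt m l) (f : Finset (Fin m) → ℝ) :
    Balanced f l ↔ f (s.itemSet m 1 0) ≤ f (s.itemSet m 1 1) + 1 ∧
      f (s.itemSet m 1 1) ≤ f (s.itemSet m 1 0) + 1 := by
  rw [Balanced, ← h.itemSet_zero, ← h.itemSet_one, abs_le]
  constructor <;> rintro ⟨h1, h2⟩ <;> constructor <;> linarith

/-- The first agent is almost indifferent at the chosen cut and the second takes the bundle it
prefers, so no monotonicity is needed. The cut at `m` is never tested: if all earlier ones fail,
`exists_balanced` leaves only this one. -/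
theorem runs_splitItems {v : Valuations 2 m} (hm : s.var 1 = m) (hv : UnitMarginals v)
    (h0 : ∀ j e, s.arr 1 j e = 0) :
    Runs v splitItems s fun s' => (AlmostEnvyFree v fun j => s'.itemSet m 1 j) ∧
      IsAllocation fun j : Fin 2 => s'.itemSet m 1 j := by
  refine .seq (.conseq (.forLt (N := m) (fun k s' => ∀ e,
      s'.arr 1 0 e = 0 ∧ (e < k → s'.arr 1 1 e = 1))
    (by decide) (fun s' hf => ?_) (by omega) (fun k s' l h => h) (by simp [h0])
    (fun k hk s' hf hk' hI => .setArr ?_) (fun s' hf _ h => h)) fun s₁ hf₁ h₁ => ?_)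
  · simp [NatExpr.eval, hf.var 1 (by decide), hm]
  · intro e
    simp only [NatExpr.eval, hk', Store.setArr_arr_self]
    refine ⟨by simpa using (hI e).1, fun he => ?_⟩
    split_ifs with h
    · rfl
    · exact (hI e).2 (by grind)
  refine .forLt (N := m) (fun k s' => ∃ l ≤ k, s'.SplitAt m l ∧
      (Balanced (v 0) l ∨ l = k ∧ ∀ j < k, ¬ Balanced (v 0) j))
    (by decide) (fun s' hf => ?_) (by omega) (fun k s' l h => h)
    ⟨0, le_rfl, fun e he => by simp [h₁ e, he], .inr ⟨rfl, by simp⟩⟩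
    (fun k hk s' hf hk' hI => ?_) (fun s' hf _ hI => ?_)
  · rw [NatExpr.eval, hf.var 1 (by decide), hf₁.var 1 (by decide), hm]
  · obtain ⟨l, hl, hS, hB⟩ := hI
    refine .seq (.query (by simp [NatExpr.eval]) (.seq (.query (by simp [NatExpr.eval]) ?_)))
    simp only [NatExpr.eval, Store.setReal_itemSet]
    set s'' := (s'.setReal 3 0 0 (v ⟨0, by decide⟩ (s'.itemSet m 1 0))).setReal 3 0 1
      (v ⟨0, by decide⟩ (s'.itemSet m 1 1)) with hs''
    have hr0 : s''.real 3 0 0 = v 0 (s'.itemSet m 1 0) := by simp [hs'']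
    have hr1 : s''.real 3 0 1 = v 0 (s'.itemSet m 1 1) := by simp [hs'']
    have hb := hS.balanced_iff (v 0)
    rw [← hr0, ← hr1] at hb
    refine .ite (fun h => .skip ⟨l, by omega, hS, .inl (hb.2 h)⟩) (fun h => ?_)
    have hnb : ¬ Balanced (v 0) l := fun h' => h (hb.1 h')
    obtain ⟨rfl, hj⟩ := hB.resolve_left hnb
    refine .seq (.setArr (.setArr ?_))
    have v9 : s''.var 9 = l := hk'
    simp only [NatExpr.eval, v9, Store.setArr_var]
    refine ⟨l + 1, le_rfl, fun e he => ?_, .inr ⟨rfl, fun j hj' => ?_⟩⟩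
    · have h1 := hS e he
      have ha : s''.arr = s'.arr := rfl
      simp only [Store.setArr_arr_self, ha, h1]
      constructor <;> split_ifs <;> grind
    · rcases Nat.lt_succ_iff_lt_or_eq.1 hj' with hj' | rfl
      exacts [hj j hj', hnb]
  · obtain ⟨l, hl, hS, hB⟩ := hI
    have hbal : Balanced (v 0) l := by
      refine hB.elim id fun h => ?_
      obtain ⟨l', hl', hb⟩ := exists_balanced (v 0) fun e X => hv 0 e X
      rcases hl'.lt_or_eq with h' | rfl
      · exact absurd hb (h.2 l' h')
      · rwa [h.1]
    rw [hS.balanced_iff] at hbal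
    refine ⟨?_, fun i j hij => ?_, fun e => ?_⟩
    · rcases le_total (v 1 (s'.itemSet m 1 0)) (v 1 (s'.itemSet m 1 1)) with h | h
      · refine ⟨1, ?_⟩
        simp only [Fin.forall_fin_two, Equiv.Perm.one_apply, Fin.coe_ofNat_eq_mod]
        norm_num
        exact ⟨hbal.2, by linarith⟩
      · refine ⟨Equiv.swap 0 1, ?_⟩
        simp only [Fin.forall_fin_two, Equiv.swap_apply_left, Equiv.swap_apply_right,
          Fin.coe_ofNat_eq_mod]
        norm_num
        exact ⟨hbal.1, by linarith⟩
    · have hd : Disjoint (s'.itemSet m 1 0) (s'.itemSet m 1 1) := by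
        rw [hS.itemSet_zero, hS.itemSet_one, Finset.disjoint_filter]
        intro e _ h
        omega
      fin_cases i <;> fin_cases j <;> first | exact absurd rfl hij | exact hd | exact hd.symm
    · rcases lt_or_ge (e : ℕ) l with h | h
      · exact ⟨0, by simp [(hS e e.2).1, h]⟩
      · exact ⟨1, by simp [(hS e e.2).2, h]⟩

/-! ### The two complete programs -/

def allocateAndSubsidize : Program :=
  .seq (.ite (.natEq (.var 0) (.const 2)) splitItems placeItems) subsidize

theorem runs_allocateAndSubsidize {v : Valuations n m} (h1 : 1 ≤ n) (hv : UnitMarginals v)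
    (h : DoublyMonotone v ∨ n = 2) :
    Runs v allocateAndSubsidize (Store.input n m) fun s' =>
      IsEnvyFreeWithSubsidy v (s'.outputAllocation n m) (s'.outputSubsidy n) ∧
      (∀ i, s'.outputSubsidy n i ≤ (n : ℝ) - 1) ∧
      ∑ i, s'.outputSubsidy n i ≤ (n : ℝ) * ((n : ℝ) - 1) / 2 := by
  have hbundles : Runs v (.ite (.natEq (.var 0) (.const 2)) splitItems placeItems)
      (Store.input n m) fun s' => (AlmostEnvyFree v fun j => s'.itemSet m 1 j) ∧
        IsAllocation fun j : Fin n => s'.itemSet m 1 j := by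
    refine .ite (fun h2 => ?_) (fun h2 => ?_)
    · obtain rfl : n = 2 := h2
      exact runs_splitItems rfl hv fun _ _ => rfl
    · exact runs_placeItems h1 rfl rfl hv (h.resolve_right h2) fun _ _ => rfl
  refine .seq (hbundles.conseq ?_)
  rintro s₁ hf₁ ⟨⟨ρ, hρ⟩, hA⟩
  refine (runs_subsidize_of_envy_le (n := n) (m := m) (k := 1) h1 (hf₁.var 0 (by decide))
    (hf₁.var 1 (by decide)) hA ρ (by simpa using hρ)).conseq ?_
  rintro s₂ - ⟨σ, -, hef, hp, hsum⟩
  exact ⟨hef, by simpa using hp, by simpa using hsum⟩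

/-- `subsidize` reads the bundles from array `1` and writes its result to array `0`, where the given
allocation is stored. -/
def copyBundles : Program :=
  forLt 3 (.var 0) <| forLt 8 (.var 1) <|
    .setArr 1 (.var 3) (.var 8) (.arr 0 (.var 3) (.var 8))

theorem runs_copyBundles {v : Valuations n m} (hn : s.var 0 = n) (hm : s.var 1 = m) :
    Runs v copyBundles s fun s' => ∀ i < n, ∀ e < m, s'.arr 1 i e = s.arr 0 i e := by
  refine .forLt (N := n) (fun k s' => ∀ i < k, ∀ e < m, s'.arr 1 i e = s.arr 0 i e)
    (by decide) (fun s' hf => ?_) (by omega) (fun k s' l h => h) (by simp)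
    (fun k hk s' hf hk' hI => ?_) (fun s' hf hs' hI => hI)
  · rw [NatExpr.eval, hf.var 0 (by decide), hn]
  refine .forLt (N := m) (fun l s'' => ∀ i e, e < m → (i < k ∨ i = k ∧ e < l) →
      s''.arr 1 i e = s.arr 0 i e)
    (by decide) (fun s'' hf' => ?_) (by omega) (fun k s' l h => h)
    (fun i e he h => hI i (by omega) e he) (fun l hl s'' hf' hl' hI' => .setArr ?_)
    (fun s'' hf' hs' hI' i hi e he => hI' i e he (by omega))
  · rw [NatExpr.eval, hf'.var 1 (by decide), hf.var 1 (by decide), hm]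
  have v3 : s''.var 3 = k := (hf'.var 3 (by decide)).trans hk'
  have a0 : s''.arr 0 = s.arr 0 := (hf'.arr 0 (by decide)).trans (hf.arr 0 (by decide))
  intro i e he hie
  simp only [NatExpr.eval, v3, hl', a0, Store.setArr_arr_self]
  split_ifs with h
  · rw [h.1, h.2]
  · exact hI' i e he (by omega)

def reassignAndSubsidize : Program := .seq copyBundles subsidize

theorem runs_reassignAndSubsidize {k : ℕ} {v : Valuations n m} {A : Fin n → Finset (Fin m)}
    (h1 : 1 ≤ n) (hv : UnitMarginals v) (hA : IsAllocation A) (hk : IsEFUpTo v k A) :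
    Runs v reassignAndSubsidize (Store.inputAllocation A) fun s' => ∃ σ : Equiv.Perm (Fin n),
      (∀ i, s'.outputAllocation n m i = A (σ i)) ∧
      IsEnvyFreeWithSubsidy v (s'.outputAllocation n m) (s'.outputSubsidy n) ∧
      (∀ i, s'.outputSubsidy n i ≤ (k : ℝ) * ((n : ℝ) - 1)) ∧
      ∑ i, s'.outputSubsidy n i ≤ (k : ℝ) * ((n : ℝ) * ((n : ℝ) - 1) / 2) := by
  refine .seq ((runs_copyBundles (s := Store.inputAllocation A) rfl rfl).conseq fun s₁ hf₁ h => ?_)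
  have hset : ∀ j : Fin n, s₁.itemSet m 1 j = A j := fun j => by
    ext e
    rw [Store.mem_itemSet, h j j.2 e e.2]
    simp [Store.inputAllocation]
  refine (runs_subsidize_of_envy_le (n := n) (m := m) (k := k) h1 (hf₁.var 0 (by decide))
    (hf₁.var 1 (by decide)) (by simpa only [hset] using hA) 1 fun i j => ?_).conseq fun s₂ _ h => ?_
  · simpa only [hset, Equiv.Perm.one_apply] using hk.envy_le hv hA i j
  · simpa only [hset] using h

end FairDivision

theorem theorem1 :
    -- existence for doubly monotone valuations and for two agents
    (∀ (n m : ℕ) (v : FairDivision.Valuations n m), 1 ≤ n → FairDivision.UnitMarginals v →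
      (FairDivision.DoublyMonotone v ∨ n = 2) →
      ∃ (A : Fin n → Finset (Fin m)) (p : Fin n → ℝ),
        FairDivision.IsEnvyFreeWithSubsidy v A p ∧
        (∀ i, p i ≤ (n : ℝ) - 1) ∧ ∑ i, p i ≤ (n : ℝ) * ((n : ℝ) - 1) / 2) ∧
    -- computation in polynomial time
    (∃ (c : FairDivision.Program) (P : Polynomial ℕ),
      ∀ (n m : ℕ) (v : FairDivision.Valuations n m), 1 ≤ n → FairDivision.UnitMarginals v →
        (FairDivision.DoublyMonotone v ∨ n = 2) →
        ∃ (t : ℕ) (s : FairDivision.Store),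
          FairDivision.Exec v c (FairDivision.Store.input n m) t s ∧ t ≤ P.eval (n + m) ∧
          FairDivision.IsEnvyFreeWithSubsidy v (s.outputAllocation n m) (s.outputSubsidy n) ∧
          (∀ i, s.outputSubsidy n i ≤ (n : ℝ) - 1) ∧
          ∑ i, s.outputSubsidy n i ≤ (n : ℝ) * ((n : ℝ) - 1) / 2) ∧
    -- existence, for general valuations, from an allocation that is envy-free up to `k` items
    (∀ (n m k : ℕ) (v : FairDivision.Valuations n m) (A : Fin n → Finset (Fin m)),
      1 ≤ n → FairDivision.UnitMarginals v →
      FairDivision.IsAllocation A → FairDivision.IsEFUpTo v k A →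
      ∃ (σ : Equiv.Perm (Fin n)) (p : Fin n → ℝ),
        FairDivision.IsEnvyFreeWithSubsidy v (fun i => A (σ i)) p ∧
        (∀ i, p i ≤ (k : ℝ) * ((n : ℝ) - 1)) ∧
        ∑ i, p i ≤ (k : ℝ) * ((n : ℝ) * ((n : ℝ) - 1) / 2)) ∧
    -- computation in polynomial time from such an allocation, by a program independent of `k`
    (∃ (c : FairDivision.Program) (P : Polynomial ℕ),
      ∀ (n m k : ℕ) (v : FairDivision.Valuations n m) (A : Fin n → Finset (Fin m)),
        1 ≤ n → FairDivision.UnitMarginals v →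
        FairDivision.IsAllocation A → FairDivision.IsEFUpTo v k A →
        ∃ (t : ℕ) (s : FairDivision.Store) (σ : Equiv.Perm (Fin n)),
          FairDivision.Exec v c (FairDivision.Store.inputAllocation A) t s ∧
          t ≤ P.eval (n + m) ∧ (∀ i, s.outputAllocation n m i = A (σ i)) ∧
          FairDivision.IsEnvyFreeWithSubsidy v (s.outputAllocation n m) (s.outputSubsidy n) ∧
          (∀ i, s.outputSubsidy n i ≤ (k : ℝ) * ((n : ℝ) - 1)) ∧
          ∑ i, s.outputSubsidy n i ≤ (k : ℝ) * ((n : ℝ) * ((n : ℝ) - 1) / 2)) := by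
  refine ⟨fun n m v hn hv h => ?_, ⟨FairDivision.allocateAndSubsidize,
    FairDivision.allocateAndSubsidize.timeBound, fun n m v hn hv h => ?_⟩,
    fun n m k v A hn hv hA hk => ?_, ⟨FairDivision.reassignAndSubsidize,
    FairDivision.reassignAndSubsidize.timeBound, fun n m k v A hn hv hA hk => ?_⟩⟩
  -- Existence is read off from the final store of the program.
  · obtain ⟨t, s, -, -, h⟩ := FairDivision.runs_allocateAndSubsidize hn hv h
    exact ⟨_, _, h⟩
  · exact FairDivision.runs_allocateAndSubsidize hn hv h
  · obtain ⟨t, s, -, -, σ, hσ, h⟩ := FairDivision.runs_reassignAndSubsidize hn hv hA hk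
    rw [show s.outputAllocation n m = fun i => A (σ i) from funext hσ] at h
    exact ⟨σ, _, h⟩
  · obtain ⟨t, s, he, ht, σ, h⟩ := FairDivision.runs_reassignAndSubsidize hn hv hA hk
    exact ⟨t, s, σ, he, ht, h⟩
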